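/- Define finite binary words by $X_{-2}=X_{-1}=X_0=0$ and $X_m=X_{m-1}\overline{X_{m-3}}$ for $m\ge 1$, where the overline denotes binary complement. Each $X_m$ is a prefix of $X_{m+1}$, and the Allouche–Johnson word $\mathbf{ja}=011110\cdots$ is their limit. Let $\rho(n)$ be the number of distinct factors of length $n$ of $\mathbf{ja}$, and let $d(n)=\rho(n+1)-\rho(n)$. Let $N_0=1$, $N_1=2$, $N_2=3$ and $N_i=N_{i-1}+N_{i-3}$ for $i\ge 3$. Every natural number $n$ has exactly one canonical representation $(n)_N=e_1e_2\cdots e_t\in\{0,1\}^*$, that is, a word with $n=\sum_{i=1}^t e_iN_{t-i}$ that does not begin with $0$ and contains neither of the blocks $11$ and $101$; $(0)_N$ is the empty word. Let $\mathtt{fdiff10}$ and $\mathtt{fdiff12}$ be the following deterministic finite automata over $\{0,1\}$. Both have the $31$ states $0,1,\dots,30$, the initial state $0$, and the same partial transition function, where $q:(a,b)$ means that the digit $0$ leads from $q$ to $a$ and the digit $1$ leads from $q$ to $b$, and where "$-$" means that the transition is undefined and the input is rejected: $0:(0,1)$, $1:(2,-)$, $2:(3,-)$, $3:(4,5)$,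 $4:(6,7)$, $5:(8,-)$, $6:(9,10)$, $7:(11,-)$, $8:(12,-)$, $9:(13,14)$, $10:(15,-)$, $11:(16,-)$, $12:(12,17)$, $13:(18,19)$, $14:(20,-)$, $15:(21,-)$, $16:(22,5)$, $17:(8,-)$, $18:(23,24)$, $19:(25,-)$, $20:(26,-)$, $21:(27,17)$, $22:(12,17)$, $23:(13,14)$, $24:(25,-)$, $25:(26,-)$, $26:(26,24)$, $27:(28,29)$, $28:(21,5)$, $29:(30,-)$, $30:(12,-)$. The accepting states of $\mathtt{fdiff10}$ are $7,8,11,12,13,14,17,18,19,20,23$; those of $\mathtt{fdiff12}$ are $4,5,6,9,10,15,16,21,22,24,25,26,27,28,29,30$. Theorem. The automaton $\mathtt{fdiff10}$ accepts exactly those $n\ge 0$ for which $d(n)=10$, and $\mathtt{fdiff12}$ accepts exactly those $n\ge 0$ for which $d(n)=12$: the words accepted by $\mathtt{fdiff10}$ (respectively $\mathtt{fdiff12}$) are precisely the words $0^k(n)_N$ with $k\ge 0$ and $d(n)=10$ (respectively $d(n)=12$). Moreover, for every $n\ge 4$, either $d(n)=10$ or $d(n)=12$. -/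

import Mathlib

/-! ### The Allouche–Johnson word

The letters `0` and `1` are `false` and `true`. -/

/-- The finite words `X_{-2} = X_{-1} = X_0 = 0` and `X_m = X_{m-1} · complement (X_{m-3})` for
`m ≥ 1`, with the index shifted by two: `ajBlock i` is `X_{i-2}`. -/
def ajBlock : ℕ → List Bool
  | 0 => [false]
  | 1 => [false]
  | 2 => [false]
  | n + 3 => ajBlock (n + 2) ++ (ajBlock n).map (fun b => !b)

/-- The infinite word `ja = 011110⋯`, the limit of the words `X_m`: its letter at position `k` is
the letter at position `k` of `X_k` (see `ajBlock_getElem?` below). -/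
def ja (k : ℕ) : Bool := (ajBlock (k + 2)).getD k false

theorem lt_length_ajBlock (k : ℕ) : k < (ajBlock (k + 2)).length := by
  have pos : ∀ n, 0 < (ajBlock n).length := by
    intro n
    induction n using ajBlock.induct with
    | case1 => simp [ajBlock]
    | case2 => simp [ajBlock]
    | case3 => simp [ajBlock]
    | case4 n ih1 ih2 => simp [ajBlock]; omega
  induction k with
  | zero => simp [ajBlock]
  | succ k ih =>
    have := pos k
    simp only [ajBlock, List.length_append, List.length_map]
    omega

theorem ajBlock_prefix {m n : ℕ} (h : m ≤ n) : ajBlock m <+: ajBlock n := by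
  induction n, h using Nat.le_induction with
  | base => exact List.prefix_refl _
  | succ n _ ih =>
    refine ih.trans ?_
    match n with
    | 0 => exact List.prefix_refl _
    | 1 => exact List.prefix_refl _
    | n + 2 => exact List.prefix_append _ _

/-- Every word `X_m` is a prefix of `ja`. -/
theorem ajBlock_getElem? (m k : ℕ) (h : k < (ajBlock m).length) :
    (ajBlock m)[k]? = some (ja k) := by
  have key : (ajBlock (k + 2))[k]? = some (ja k) := by
    have := lt_length_ajBlock k
    simp [ja, List.getD_eq_getElem?_getD, this]
  rw [← key]
  rcases le_total m (k + 2) with hm | hm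
  · obtain ⟨t, ht⟩ := ajBlock_prefix hm
    rw [← ht, List.getElem?_append_left h]
  · obtain ⟨t, ht⟩ := ajBlock_prefix hm
    rw [← ht, List.getElem?_append_left (lt_length_ajBlock k)]

/-! ### Subword complexity -/

/-- The factor of length `n` of the infinite word `x` that starts at position `i`. -/
def factorAt {A : Type*} (x : ℕ → A) (n i : ℕ) : Fin n → A := fun j => x (i + j)

/-- The subword complexity of the infinite word `x`: the number of its distinct factors of
length `n`. -/
noncomputable def subwordComplexity {A : Type*} (x : ℕ → A) (n : ℕ) : ℕ :=
  (Set.range (factorAt x n)).ncard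

/-- The first difference `ρ_ja(n+1) - ρ_ja(n)`. -/
noncomputable def jaDiff (n : ℕ) : ℤ :=
  (subwordComplexity ja (n + 1) : ℤ) - (subwordComplexity ja n : ℤ)

/-! ### The Narayana numeration system

Representations are words over `{0, 1}`, most significant digit first. -/

/-- The Narayana numbers `1, 2, 3, 4, 6, 9, 13, 19, 28, …`. -/
def narayana : ℕ → ℕ
  | 0 => 1
  | 1 => 2
  | 2 => 3
  | n + 3 => narayana (n + 2) + narayana n

/-- The value `[e₁ ⋯ e_t]_N = ∑ e_i N_{t-i}` of a word. -/
def narayanaValue : List Bool → ℕ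
  | [] => 0
  | e :: w => (if e then narayana w.length else 0) + narayanaValue w

/-- The word contains neither of the blocks `11` and `101`. -/
def NarayanaAdmissible (w : List Bool) : Prop :=
  ¬ [true, true] <:+: w ∧ ¬ [true, false, true] <:+: w

/-- `w` is a canonical representation of `n`: its leading digit, if there is one, is nonzero, it
contains neither of the blocks `11` and `101`, and its value is `n`. -/
def IsNarayanaRep (w : List Bool) (n : ℕ) : Prop :=
  w.head? ≠ some false ∧ NarayanaAdmissible w ∧ narayanaValue w = n

theorem narayanaAdmissible_nil : NarayanaAdmissible [] := by
  simp [NarayanaAdmissible]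

theorem narayanaAdmissible_false (w : List Bool) :
    NarayanaAdmissible (false :: w) ↔ NarayanaAdmissible w := by
  simp [NarayanaAdmissible, List.infix_cons_iff]

theorem narayanaAdmissible_true (w : List Bool) :
    NarayanaAdmissible (true :: w) ↔
      w = [] ∨ w = [false] ∨ ∃ v, w = false :: false :: v ∧ NarayanaAdmissible v := by
  match w with
  | [] => simp [NarayanaAdmissible, List.infix_cons_iff]
  | [false] => simp [NarayanaAdmissible, List.infix_cons_iff]
  | true :: v => simp [NarayanaAdmissible, List.infix_cons_iff]
  | false :: true :: v => simp [NarayanaAdmissible, List.infix_cons_iff]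
  | false :: false :: v => simp [NarayanaAdmissible, List.infix_cons_iff]

theorem NarayanaAdmissible.tail {e : Bool} {w : List Bool} (h : NarayanaAdmissible (e :: w)) :
    NarayanaAdmissible w :=
  ⟨fun h' => h.1 (h'.trans (List.suffix_cons e w).isInfix),
    fun h' => h.2 (h'.trans (List.suffix_cons e w).isInfix)⟩

theorem narayana_strictMono : StrictMono narayana := by
  have pos : ∀ n, 0 < narayana n := by
    intro n
    induction n using narayana.induct with
    | case1 => simp [narayana]
    | case2 => simp [narayana]
    | case3 => simp [narayana]
    | case4 n ih1 ih2 => simp [narayana]; omega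
  refine strictMono_nat_of_lt_succ fun n => ?_
  match n with
  | 0 => simp [narayana]
  | 1 => simp [narayana]
  | n + 2 => have := pos n; simp [narayana]; omega

theorem narayanaValue_lt (w : List Bool) (h : NarayanaAdmissible w) :
    narayanaValue w < narayana w.length := by
  match w with
  | [] => simp [narayana, narayanaValue]
  | false :: w =>
    have := narayanaValue_lt w h.tail
    have h2 := narayana_strictMono (Nat.lt_succ_self w.length)
    simp only [narayanaValue, List.length_cons]
    simp only [Nat.succ_eq_add_one] at h2
    simp
    omega
  | true :: w =>
    rcases (narayanaAdmissible_true w).1 h with rfl | rfl | ⟨v, rfl, hv⟩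
    · simp [narayana, narayanaValue]
    · simp [narayana, narayanaValue]
    · have := narayanaValue_lt v hv
      simp [narayana, narayanaValue]
      omega
termination_by w.length

theorem exists_narayana_word (k n : ℕ) (h : n < narayana k) :
    ∃ w : List Bool, w.length = k ∧ NarayanaAdmissible w ∧ narayanaValue w = n := by
  match k with
  | 0 =>
    refine ⟨[], rfl, narayanaAdmissible_nil, ?_⟩
    simp [narayana] at h
    simp [narayanaValue, h]
  | k + 1 =>
    by_cases hk : n < narayana k
    · obtain ⟨w, rfl, hw, rfl⟩ := exists_narayana_word k n hk
      exact ⟨false :: w, rfl, (narayanaAdmissible_false w).2 hw, by simp [narayanaValue]⟩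
    · match k with
      | 0 =>
        refine ⟨[true], rfl, (narayanaAdmissible_true _).2 (Or.inl rfl), ?_⟩
        simp [narayana] at h hk
        simp [narayanaValue, narayana]
        omega
      | 1 =>
        refine ⟨[true, false], rfl, (narayanaAdmissible_true _).2 (Or.inr (Or.inl rfl)), ?_⟩
        simp [narayana] at h hk
        simp [narayanaValue, narayana]
        omega
      | k + 2 =>
        have h' : n - narayana (k + 2) < narayana k := by
          simp only [narayana] at h ⊢
          omega
        obtain ⟨w, rfl, hw, hn⟩ := exists_narayana_word k _ h'
        refine ⟨true :: false :: false :: w, rfl,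
          (narayanaAdmissible_true _).2 (Or.inr (Or.inr ⟨w, rfl, hw⟩)), ?_⟩
        have e : narayana (w.length + 1 + 1) = narayana (w.length + 2) := rfl
        simp [narayanaValue, hn]
        omega

theorem narayanaValue_inj (u v : List Bool) (hl : u.length = v.length)
    (hu : NarayanaAdmissible u) (hv : NarayanaAdmissible v)
    (h : narayanaValue u = narayanaValue v) : u = v := by
  induction u generalizing v with
  | nil => simpa [eq_comm] using hl
  | cons a u ih =>
    match v with
    | [] => simp at hl
    | b :: v =>
      have hl' : u.length = v.length := by simpa using hl
      have h1 := narayanaValue_lt u hu.tail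
      have h2 := narayanaValue_lt v hv.tail
      simp only [narayanaValue] at h
      rw [hl'] at h h1
      have hab : a = b := by
        cases a <;> cases b <;> simp at h ⊢ <;> omega
      subst hab
      rw [ih v hl' hu.tail hv.tail (by omega)]

/-- Every natural number has exactly one canonical Narayana representation. -/
theorem existsUnique_isNarayanaRep (n : ℕ) : ∃! w, IsNarayanaRep w n := by
  refine existsUnique_of_exists_of_unique ?_ ?_
  · obtain ⟨w, -, hw, hn⟩ := exists_narayana_word (n + 1) n
      (narayana_strictMono.id_le (n + 1))
    have strip : ∀ w, NarayanaAdmissible w → ∃ u, IsNarayanaRep u (narayanaValue w) := by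
      intro w
      induction w with
      | nil => exact fun h => ⟨[], by simp, h, rfl⟩
      | cons a w ih =>
        intro h
        cases a with
        | true => exact ⟨true :: w, by simp, h, rfl⟩
        | false => simpa [narayanaValue] using ih h.tail
    exact hn ▸ strip w hw
  · have key : ∀ u v, IsNarayanaRep u n → IsNarayanaRep v n → u.length ≤ v.length := by
      rintro (_ | ⟨a, u⟩) v ⟨hu, hu', hu''⟩ ⟨hv, hv', hv''⟩
      · simp
      · by_contra hlt
        have ha : a = true := by simpa using hu
        subst ha
        have h1 := narayanaValue_lt v hv'
        have h2 : narayana v.length ≤ narayana u.length :=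
          narayana_strictMono.monotone (by simp at hlt; omega)
        simp only [narayanaValue, if_true] at hu''
        omega
    intro u v hu hv
    exact narayanaValue_inj u v (le_antisymm (key u v hu hv) (key v u hv hu)) hu.2.1 hv.2.1
      (hu.2.2.trans hv.2.2.symm)

/-- The canonical representation `(n)_N` of `n`; that of `0` is the empty word. -/
noncomputable def narayanaRep (n : ℕ) : List Bool := (existsUnique_isNarayanaRep n).choose

theorem narayanaRep_spec (n : ℕ) : IsNarayanaRep (narayanaRep n) n :=
  (existsUnique_isNarayanaRep n).choose_spec.1

/-! ### Narayana automata -/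

/-- A deterministic finite automaton over `{0, 1}` with `s` states and a partial transition
function; a run that meets an undefined transition rejects. -/
structure PartialAutomaton (s : ℕ) where
  step : Fin s → Bool → Option (Fin s)
  start : Fin s
  accept : Finset (Fin s)

/-- The automaton accepts the word `w`. -/
def PartialAutomaton.Accepts {s : ℕ} (M : PartialAutomaton s) (w : List Bool) : Prop :=
  ∃ q ∈ w.foldlM M.step M.start, q ∈ M.accept

/-- `M`, as a Narayana automaton, accepts exactly the numbers in `S`: the words that it accepts
are the canonical representations of the elements of `S`, with any number of leading zeros. -/
def PartialAutomaton.Recognizes {s : ℕ} (M : PartialAutomaton s) (S : Set ℕ) : Prop :=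
  ∀ w : List Bool, M.Accepts w ↔ ∃ n ∈ S, ∃ k, w = List.replicate k false ++ narayanaRep n

/-- The common transition function of the two automata: row `q` lists the states that are reached
from `q` on the digits `0` and `1`. -/
def fdiffStep (q : Fin 31) (e : Bool) : Option (Fin 31) :=
  let row : Option (Fin 31) × Option (Fin 31) := ![
    (some 0, some 1), (some 2, none), (some 3, none), (some 4, some 5),
    (some 6, some 7), (some 8, none), (some 9, some 10), (some 11, none),
    (some 12, none), (some 13, some 14), (some 15, none), (some 16, none),
    (some 12, some 17), (some 18, some 19), (some 20, none), (some 21, none),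
    (some 22, some 5), (some 8, none), (some 23, some 24), (some 25, none),
    (some 26, none), (some 27, some 17), (some 12, some 17), (some 13, some 14),
    (some 25, none), (some 26, none), (some 26, some 24), (some 28, some 29),
    (some 21, some 5), (some 30, none), (some 12, none)] q
  if e then row.2 else row.1

/-- The automaton `fdiff10`. -/
def fdiff10 : PartialAutomaton 31 where
  step := fdiffStep
  start := 0
  accept := {7, 8, 11, 12, 13, 14, 17, 18, 19, 20, 23}

/-- The automaton `fdiff12`. -/
def fdiff12 : PartialAutomaton 31 where
  step := fdiffStep
  start := 0
  accept := {4, 5, 6, 9, 10, 15, 16, 21, 22, 24, 25, 26, 27, 28, 29, 30}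

/-! The word `ja` is a letter-to-letter coding of the fixed point of the morphism φ (`subst`) on
`Fin 6`, where adding 3 is complementation and |φ^k(0)| = N_k. Since prefixes of `ja` recur, d(n) is
the number of left special factors of length n (`subwordComplexity_succ`), so the task is to list
these.

In the fixed point, only 0 and 3 have more than one possible predecessor. Desubstituting a pair of
occurrences of a left special factor therefore ends, up to sign, at the pair x01 (x ≠ 5) against 500
or 503 (`exists_isBasePair`). Following the images of this pair to their first mismatch
(`IsBasePair.exists_mismatch`) shows that a long left special factor is, up to sign, a prefix of the
fixed point, except for one family: words of length up to N_{m+5} + N_m that leave the prefix after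
N_{m+5} letters.

A letter can be recovered from five consecutive codes, so the left special factors of `ja` are the
same words preceded by b^e with e ≤ 2. The prefixes give 2 + 4 + 4 = 10 words. The exceptional
family has e = m mod 3 and adds two words, one for each sign, exactly when N_{m+5} + m mod 3 < n ≤
N_{m+5} + m mod 3 + N_m. Hence d(n) is 10 or 12 for n ≥ 11 (`ncard_leftSpecial_ja`); smaller n are
computed.

For n ≥ 19 the representation is 100v, and the automata test from state 3 whether the value of v
lies in that interval. `acceptCondition` is the invariant of this test. -/

/-! ### The underlying six-letter fixed point

The letters are the elements of `Fin 6`; adding `3` corresponds to complementation. -/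

/-- The morphism `0 ↦ 01, 1 ↦ 2, 2 ↦ 3, 3 ↦ 34, 4 ↦ 5, 5 ↦ 0`. -/
def subst (x : Fin 6) : List (Fin 6) :=
  if x = 0 ∨ x = 3 then [x, x + 1] else [x + 1]

/-- The `n`-th iterate of the morphism, on words. -/
def substIter : ℕ → List (Fin 6) → List (Fin 6)
  | 0, l => l
  | n + 1, l => substIter n (l.flatMap subst)

theorem substIter_succ' (n : ℕ) (l : List (Fin 6)) :
    substIter (n + 1) l = (substIter n l).flatMap subst := by
  induction n generalizing l with
  | zero => rfl
  | succ n ih => exact ih _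

theorem substIter_append (n : ℕ) (l m : List (Fin 6)) :
    substIter n (l ++ m) = substIter n l ++ substIter n m := by
  induction n generalizing l m with
  | zero => rfl
  | succ n ih => simp [substIter, ih]

theorem subst_length_pos (x : Fin 6) : 0 < (subst x).length := by
  unfold subst; split <;> simp

theorem length_le_length_flatMap_subst (l : List (Fin 6)) :
    l.length ≤ (l.flatMap subst).length := by
  induction l with
  | nil => simp
  | cons a l ih => have := subst_length_pos a; simp at ih ⊢; omega

theorem length_le_length_substIter (n : ℕ) (l : List (Fin 6)) :
    l.length ≤ (substIter n l).length := by
  induction n generalizing l with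
  | zero => exact le_rfl
  | succ n ih => exact (length_le_length_flatMap_subst l).trans (ih _)

theorem subst_add_three (x : Fin 6) : subst (x + 3) = (subst x).map (· + 3) := by
  revert x; decide

theorem substIter_map_add_three (n : ℕ) (l : List (Fin 6)) :
    substIter n (l.map (· + 3)) = (substIter n l).map (· + 3) := by
  induction n generalizing l with
  | zero => rfl
  | succ n ih =>
    simp only [substIter]
    rw [← ih, List.flatMap_map, List.map_flatMap]
    simp only [subst_add_three]

theorem substIter_zero_succ (n : ℕ) :
    substIter (n + 1) [0] = substIter n [0] ++ substIter n [1] :=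
  substIter_append n [0] [1]

theorem substIter_zero_prefix {m n : ℕ} (h : m ≤ n) : substIter m [0] <+: substIter n [0] := by
  induction n, h using Nat.le_induction with
  | base => exact List.prefix_refl _
  | succ n _ ih => exact ih.trans (substIter_zero_succ n ▸ List.prefix_append _ _)

theorem lt_length_substIter_zero (n : ℕ) : n < (substIter n [0]).length := by
  induction n with
  | zero => simp [substIter]
  | succ n ih =>
    have := length_le_length_substIter n [1]
    rw [substIter_zero_succ, List.length_append]
    simp at this
    omega

/-- The fixed point `0 1 2 3 3 4 ⋯` of the morphism. -/
def fixWord (i : ℕ) : Fin 6 := (substIter i [0]).getD i 0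

theorem substIter_zero_getElem? (m k : ℕ) (h : k < (substIter m [0]).length) :
    (substIter m [0])[k]? = some (fixWord k) := by
  have key : (substIter k [0])[k]? = some (fixWord k) := by
    simp [fixWord, List.getD_eq_getElem?_getD, lt_length_substIter_zero k]
  rw [← key]
  rcases le_total m k with hm | hm
  · obtain ⟨t, ht⟩ := substIter_zero_prefix hm
    rw [← ht, List.getElem?_append_left h]
  · obtain ⟨t, ht⟩ := substIter_zero_prefix hm
    rw [← ht, List.getElem?_append_left (lt_length_substIter_zero k)]

/-- The factor of the fixed point of length `n` at position `i`, as a list. -/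
def fixWindow (i n : ℕ) : List (Fin 6) := (List.range n).map fun t => fixWord (i + t)

@[simp] theorem length_fixWindow (i n : ℕ) : (fixWindow i n).length = n := by simp [fixWindow]

theorem fixWindow_getElem (i n t : ℕ) (h : t < (fixWindow i n).length) :
    (fixWindow i n)[t] = fixWord (i + t) := by simp [fixWindow]

theorem fixWindow_append (i m n : ℕ) :
    fixWindow i (m + n) = fixWindow i m ++ fixWindow (i + m) n := by
  simp [fixWindow, List.range_add, Function.comp_def, add_assoc]

theorem eq_fixWindow_of_prefix {l : List (Fin 6)} {n : ℕ} (h : l <+: substIter n [0]) :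
    l = fixWindow 0 l.length := by
  refine List.ext_getElem (by simp) fun t h1 h2 => ?_
  have h3 := substIter_zero_getElem? n t (h1.trans_le h.length_le)
  obtain ⟨r, hr⟩ := h
  rw [← hr, List.getElem?_append_left h1, List.getElem?_eq_getElem h1] at h3
  rw [fixWindow_getElem, zero_add]
  exact Option.some.inj h3

theorem fixWindow_prefix (i : ℕ) : fixWindow 0 i <+: substIter i [0] := by
  have h1 := eq_fixWindow_of_prefix (List.take_prefix i (substIter i [0]))
  have h2 := lt_length_substIter_zero i
  rw [List.length_take, min_eq_left h2.le] at h1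
  exact h1 ▸ List.take_prefix _ _

/-! ### Positions of images of letters, and desubstitution. -/

/-- The position at which the image of the `i`-th letter of the fixed point starts. -/
def shift (i : ℕ) : ℕ := ((fixWindow 0 i).flatMap subst).length

theorem flatMap_fixWindow_zero (i : ℕ) :
    (fixWindow 0 i).flatMap subst = fixWindow 0 (shift i) := by
  refine eq_fixWindow_of_prefix (n := i + 1) ?_
  rw [substIter_succ']
  obtain ⟨t, ht⟩ := fixWindow_prefix i
  rw [← ht, List.flatMap_append]
  exact List.prefix_append _ _

theorem shift_zero : shift 0 = 0 := rfl

theorem flatMap_fixWindow (i n : ℕ) :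
    (fixWindow i n).flatMap subst = fixWindow (shift i) (shift (i + n) - shift i) ∧
      shift i + n ≤ shift (i + n) := by
  have h1 := flatMap_fixWindow_zero (i + n)
  have h2 : shift (i + n) = shift i + ((fixWindow i n).flatMap subst).length := by
    rw [shift, fixWindow_append, List.flatMap_append, List.length_append, zero_add]; rfl
  have h3 := length_le_length_flatMap_subst (fixWindow i n)
  rw [length_fixWindow] at h3
  refine ⟨?_, by omega⟩
  obtain ⟨d, hd⟩ : ∃ d, shift (i + n) = shift i + d := ⟨_, h2⟩
  rw [hd, fixWindow_append, fixWindow_append, List.flatMap_append, flatMap_fixWindow_zero] at h1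
  simpa [hd] using h1

theorem shift_succ (i : ℕ) : shift (i + 1) = shift i + (subst (fixWord i)).length := by
  rw [shift, fixWindow_append, List.flatMap_append, List.length_append]
  simp [fixWindow, shift]

theorem subst_fixWord (i : ℕ) :
    subst (fixWord i) = fixWindow (shift i) (subst (fixWord i)).length := by
  have := (flatMap_fixWindow i 1).1
  rw [shift_succ] at this
  simpa [fixWindow] using this

theorem fixWord_zero : fixWord 0 = 0 := rfl

/-- The first letter of the image of a letter. -/
def substHead (x : Fin 6) : Fin 6 := if x = 0 ∨ x = 3 then x else x + 1

theorem fixWord_shift (i : ℕ) : fixWord (shift i) = substHead (fixWord i) := by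
  have h := subst_fixWord i
  generalize fixWord i = x at h ⊢
  unfold subst substHead at *
  split <;> simp_all [fixWindow, List.range_succ]

theorem shift_succ_of_one {i : ℕ} (h : ¬(fixWord i = 0 ∨ fixWord i = 3)) :
    shift (i + 1) = shift i + 1 := by
  rw [shift_succ, subst, if_neg h]; rfl

theorem shift_succ_of_two {i : ℕ} (h : fixWord i = 0 ∨ fixWord i = 3) :
    shift (i + 1) = shift i + 2 := by
  rw [shift_succ, subst, if_pos h]; rfl

theorem fixWord_shift_add_one {i : ℕ} (hi : fixWord i = 0 ∨ fixWord i = 3) :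
    fixWord (shift i + 1) = fixWord i + 1 := by
  have h := subst_fixWord i
  rw [subst, if_pos hi] at h
  simp [fixWindow, List.range_succ] at h
  exact h.2.symm

/-- Whether it has one letter or two, φ(x) ends in x + 1. Distinct letters thus have images with
distinct last letters, which lets left special factors be pulled back along φ. -/
theorem fixWord_shift_succ_sub_one (i : ℕ) : fixWord (shift (i + 1) - 1) = fixWord i + 1 := by
  by_cases h : fixWord i = 0 ∨ fixWord i = 3
  · rw [shift_succ_of_two h]; exact fixWord_shift_add_one h
  · rw [shift_succ_of_one h, Nat.add_sub_cancel, fixWord_shift, substHead, if_neg h]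

theorem shift_strictMono : StrictMono shift := by
  refine strictMono_nat_of_lt_succ fun n => ?_
  have := subst_length_pos (fixWord n)
  rw [shift_succ]; omega

/-- Every position is the first or the second one of the image of a letter. -/
theorem exists_shift (p : ℕ) :
    ∃ i, i ≤ p ∧ (p = shift i ∨ p = shift i + 1 ∧ (fixWord i = 0 ∨ fixWord i = 3)) := by
  induction p with
  | zero => exact ⟨0, le_rfl, Or.inl rfl⟩
  | succ p ih =>
    obtain ⟨i, hi, rfl | ⟨rfl, h⟩⟩ := ih
    · by_cases h : fixWord i = 0 ∨ fixWord i = 3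
      · exact ⟨i, by omega, Or.inr ⟨rfl, h⟩⟩
      · exact ⟨i + 1, by omega, Or.inl (shift_succ_of_one h).symm⟩
    · exact ⟨i + 1, by omega, Or.inl (shift_succ_of_two h).symm⟩

/-- The coding `0, 4, 5 ↦ 0` and `1, 2, 3 ↦ 1`. -/
def code (x : Fin 6) : Bool := x == 1 || x == 2 || x == 3

theorem code_add_three (x : Fin 6) : code (x + 3) = !code x := by revert x; decide

/-- As φ²(0) = 012 and φ³(0) = 0123, one has φ^{n+3}(0) = φ^{n+2}(0) φ^n(3). This is the recurrence
of the words X_m, because 3 is the complement of 0. -/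
theorem ajBlock_eq_map_code (m : ℕ) : ajBlock (m + 2) = (substIter m [0]).map code := by
  induction m using narayana.induct with
  | case1 => decide
  | case2 => decide
  | case3 => decide
  | case4 n ih1 ih2 =>
    have h : substIter (n + 3) [0] = substIter (n + 2) [0] ++ (substIter n [0]).map (· + 3) := by
      rw [← substIter_map_add_three]
      exact substIter_append n [0, 1, 2] [3]
    rw [h, List.map_append, ← ih1, show n + 3 + 2 = (n + 2) + 3 from rfl, ajBlock, ih2]
    simp [Function.comp_def, code_add_three]

theorem ja_eq_code (p : ℕ) : ja p = code (fixWord p) := by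
  have h1 := lt_length_substIter_zero p
  have h2 := ajBlock_getElem? (p + 2) p (lt_length_ajBlock p)
  rw [ajBlock_eq_map_code, List.getElem?_map, substIter_zero_getElem? p p h1] at h2
  exact (Option.some.inj h2).symm

/-! ### Left special factors and the first difference of the complexity -/

/-- The left special factors of length `n` of a binary word. -/
def leftSpecial (x : ℕ → Bool) (n : ℕ) : Set (Fin n → Bool) :=
  {u | ∃ i j, x i ≠ x j ∧ factorAt x n (i + 1) = u ∧ factorAt x n (j + 1) = u}

theorem factorAt_succ (x : ℕ → Bool) (n i : ℕ) :
    factorAt x (n + 1) i = Fin.cons (x i) (factorAt x n (i + 1)) := by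
  funext t
  refine Fin.cases ?_ (fun t => ?_) t
  · simp [factorAt]
  · simp [factorAt]; congr 1; omega

/-- Factors of length n + 1 that begin with b correspond to the set `F b` of their tails. The two
sets have the left special factors as intersection, and all factors of length n as union, because
`hx` gives even the prefix a predecessor. Inclusion–exclusion finishes. -/
theorem subwordComplexity_succ (x : ℕ → Bool)
    (hx : ∀ n, ∃ i, factorAt x n (i + 1) = factorAt x n 0) (n : ℕ) :
    subwordComplexity x (n + 1) = subwordComplexity x n + (leftSpecial x n).ncard := by
  set F : Bool → Set (Fin n → Bool) := fun b => {u | ∃ i, x i = b ∧ factorAt x n (i + 1) = u}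
  have hunion : F false ∪ F true = Set.range (factorAt x n) := by
    ext u
    constructor
    · rintro (⟨i, -, rfl⟩ | ⟨i, -, rfl⟩) <;> exact ⟨_, rfl⟩
    · rintro ⟨i, rfl⟩
      obtain ⟨j, hj⟩ : ∃ j, factorAt x n (j + 1) = factorAt x n i := by
        cases i with
        | zero => exact hx n
        | succ i => exact ⟨i, rfl⟩
      cases hb : x j
      · exact Or.inl ⟨j, hb, hj⟩
      · exact Or.inr ⟨j, hb, hj⟩
  have hinter : F false ∩ F true = leftSpecial x n := by
    ext u
    constructor
    · rintro ⟨⟨i, hi, hi'⟩, ⟨j, hj, hj'⟩⟩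
      exact ⟨i, j, by simp [hi, hj], hi', hj'⟩
    · rintro ⟨i, j, h, hi, hj⟩
      cases hb : x i
      · exact ⟨⟨i, hb, hi⟩, ⟨j, by rw [hb] at h; simpa using h.symm, hj⟩⟩
      · exact ⟨⟨j, by rw [hb] at h; simpa using h.symm, hj⟩, ⟨i, hb, hi⟩⟩
  have hsucc : Set.range (factorAt x (n + 1)) =
      (fun u => (Fin.cons false u : Fin (n + 1) → Bool)) '' F false ∪
        (fun u => (Fin.cons true u : Fin (n + 1) → Bool)) '' F true := by
    ext u
    constructor
    · rintro ⟨i, rfl⟩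
      rw [factorAt_succ]
      cases hb : x i
      · exact Or.inl ⟨_, ⟨i, hb, rfl⟩, rfl⟩
      · exact Or.inr ⟨_, ⟨i, hb, rfl⟩, rfl⟩
    · rintro (⟨_, ⟨i, hb, rfl⟩, rfl⟩ | ⟨_, ⟨i, hb, rfl⟩, rfl⟩)
      · exact ⟨i, by rw [factorAt_succ, hb]⟩
      · exact ⟨i, by rw [factorAt_succ, hb]⟩
  have hdisj : Disjoint ((fun u => (Fin.cons false u : Fin (n + 1) → Bool)) '' F false)
      ((fun u => (Fin.cons true u : Fin (n + 1) → Bool)) '' F true) := by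
    rw [Set.disjoint_left]
    rintro _ ⟨u, -, rfl⟩ ⟨v, -, h⟩
    simpa using congrFun h 0
  rw [subwordComplexity, subwordComplexity, hsucc, Set.ncard_union_eq hdisj,
    Set.ncard_image_of_injective _ (Fin.cons_right_injective (α := fun _ => Bool) false),
    Set.ncard_image_of_injective _ (Fin.cons_right_injective (α := fun _ => Bool) true), ← hunion, ← hinter,
    Set.ncard_union_add_ncard_inter]

/-! ### Short factors of the fixed point -/

/-- The factors of length `L` of the word `l` at the positions in the list `ps`. -/
def listFactors (L : ℕ) (l : List (Fin 6)) (ps : List ℕ) : List (List (Fin 6)) :=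
  ps.map fun p => (l.drop p).take L

/-- A list of words of length `L` that contains the prefix of the fixed point and is closed under
taking images and cutting them to length `L` contains every factor of length `L`. -/
theorem fixWindow_mem_of_closed (L : ℕ) (F : List (List (Fin 6))) (h0 : fixWindow 0 L ∈ F)
    (h1 : ∀ u ∈ F, (u.flatMap subst).take L ∈ F)
    (h2 : ∀ u ∈ F, (u.headD 1 = 0 ∨ u.headD 1 = 3) → ((u.flatMap subst).drop 1).take L ∈ F)
    (p : ℕ) : fixWindow p L ∈ F := by
  induction p using Nat.strong_induction_on with
  | _ p ih =>
    rcases Nat.eq_zero_or_pos p with rfl | hp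
    · exact h0
    obtain ⟨i, hi, h⟩ := exists_shift p
    have hip : i < p := by
      rcases Nat.eq_zero_or_pos i with rfl | hi0
      · exact hp
      -- The image of the first letter has two letters, so desubstitution moves every position
      -- except 0 strictly to the left.
      · have hs : ∀ m, m + 2 ≤ shift (m + 1) := by
          intro m
          induction m with
          | zero => decide
          | succ m ih => have := shift_strictMono (Nat.lt_succ_self (m + 1)); simp at this; omega
        have := hs (i - 1)
        rw [Nat.sub_add_cancel hi0] at this
        omega
    have hw := ih i hip
    obtain ⟨h3, h4⟩ := flatMap_fixWindow i L
    have htake : ∀ a m, L ≤ m → (fixWindow a m).take L = fixWindow a L := by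
      intro a m hm
      obtain ⟨d, rfl⟩ := Nat.exists_eq_add_of_le hm
      rw [fixWindow_append, List.take_append_of_le_length (by simp), List.take_of_length_le (by simp)]
    rcases h with rfl | ⟨rfl, h⟩
    · have := h1 _ hw
      rwa [h3, htake _ _ (by omega)] at this
    · rcases Nat.eq_zero_or_pos L with rfl | hL
      · simpa [fixWindow] using hw
      have hh : (fixWindow i L).headD 1 = fixWord i := by
        obtain ⟨L, rfl⟩ := Nat.exists_eq_succ_of_ne_zero hL.ne'
        simp [fixWindow, List.range_succ_eq_map]
      have := h2 _ hw (by rwa [hh])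
      rw [h3] at this
      -- One letter of the image is dropped, so L + 1 are needed; the first letter, 0 or 3,
      -- contributes two of them.
      have h5 : shift i + L + 1 ≤ shift (i + L) := by
        have h6 := shift_succ_of_two h
        have h7 := (flatMap_fixWindow (i + 1) (L - 1)).2
        rw [show i + 1 + (L - 1) = i + L by omega] at h7
        omega
      obtain ⟨d, hd⟩ := Nat.exists_eq_add_of_le (show 1 ≤ shift (i + L) - shift i by omega)
      rw [hd, fixWindow_append, List.drop_append_of_le_length (by simp),
        List.drop_of_length_le (by simp), List.nil_append, htake _ _ (by omega)] at this
      exact this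

/-- The factors of length `5` of the fixed point. -/
def fixFactorsFive : List (List (Fin 6)) :=
  listFactors 5 (substIter 13 [0])
    [0, 1, 2, 3, 4, 5, 6, 7, 8, 9, 10, 11, 12, 13, 14, 15, 16, 17, 18, 21, 22, 23, 24, 25, 26, 27,
      33, 34, 35, 36, 39, 40, 50, 51, 52, 53, 59, 75, 76, 77, 78, 113, 114, 115, 168, 169]

theorem fixWindow_five_mem (p : ℕ) : fixWindow p 5 ∈ fixFactorsFive := by
  refine fixWindow_mem_of_closed 5 _ ?_ ?_ ?_ p <;> decide +kernel

/-- The device that turns a local property of the fixed point into a finite check. -/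
theorem fixWord_window_five {Q : Fin 6 → Fin 6 → Fin 6 → Fin 6 → Fin 6 → Prop}
    (hQ : ∀ u ∈ fixFactorsFive,
      Q (u.getD 0 0) (u.getD 1 0) (u.getD 2 0) (u.getD 3 0) (u.getD 4 0)) (p : ℕ) :
    Q (fixWord p) (fixWord (p + 1)) (fixWord (p + 2)) (fixWord (p + 3)) (fixWord (p + 4)) := by
  simpa [fixWindow] using hQ _ (fixWindow_five_mem p)

/-- A letter of the fixed point is determined by the codes of the letters around it. -/
theorem fixWord_eq_of_code (p q : ℕ)
    (h : ∀ t < 5, code (fixWord (p + t)) = code (fixWord (q + t))) :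
    fixWord (p + 2) = fixWord (q + 2) := by
  have key : ∀ u ∈ fixFactorsFive, ∀ v ∈ fixFactorsFive,
      u.map code = v.map code → u.getD 2 0 = v.getD 2 0 := by decide +kernel
  have := key _ (fixWindow_five_mem p) _ (fixWindow_five_mem q) (by
    refine List.ext_getElem (by simp) fun t h1 h2 => ?_
    simpa [fixWindow] using h t (by simpa using h1))
  simpa [fixWindow] using this

/-! ### Iterating the desubstitution -/

/-- The letter `0` or `3` that is added by a sign. -/
def sgn (σ : Bool) : Fin 6 := if σ then 3 else 0

theorem code_add_sgn (x : Fin 6) (σ : Bool) : code (x + sgn σ) = (code x ^^ σ) := by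
  revert x σ; decide

/-- The factors of length `n` at the positions `i` and `j` agree up to the sign `σ`. -/
def Agree (σ : Bool) (i j n : ℕ) : Prop := ∀ t < n, fixWord (i + t) = fixWord (j + t) + sgn σ

theorem agree_iff_fixWindow (σ : Bool) (i j n : ℕ) :
    Agree σ i j n ↔ fixWindow i n = (fixWindow j n).map (· + sgn σ) := by
  simp [fixWindow, Agree]

theorem Agree.mono {σ : Bool} {i j m n : ℕ} (h : Agree σ i j n) (hmn : m ≤ n) :
    Agree σ i j m := fun t ht => h t (ht.trans_le hmn)

theorem Agree.symm_false {i j n : ℕ} (h : Agree false i j n) : Agree false j i n := by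
  intro t ht; have := h t ht; simp [sgn] at this ⊢; exact this.symm

theorem Agree.trans_false {σ : Bool} {i j k n : ℕ} (h : Agree false i j n) (h' : Agree σ j k n) :
    Agree σ i k n := by
  intro t ht; rw [← h' t ht, h t ht]; simp [sgn]

theorem Agree.append {σ : Bool} {i j m n : ℕ} (h : Agree σ i j m)
    (h' : Agree σ (i + m) (j + m) n) : Agree σ i j (m + n) := by
  intro t ht
  rcases lt_or_ge t m with h1 | h1
  · exact h t h1
  · obtain ⟨d, rfl⟩ := Nat.exists_eq_add_of_le h1
    have := h' d (by omega)
    rwa [add_assoc, add_assoc] at this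

theorem agree_one {σ : Bool} {i j : ℕ} (h : fixWord i = fixWord j + sgn σ) : Agree σ i j 1 := by
  intro t ht
  obtain rfl : t = 0 := by omega
  exact h

theorem agree_two {σ : Bool} {i j : ℕ} (h : fixWord i = fixWord j + sgn σ)
    (h' : fixWord (i + 1) = fixWord (j + 1) + sgn σ) : Agree σ i j 2 :=
  (agree_one h).append (agree_one h')

theorem Agree.shift {σ : Bool} {i j n : ℕ} (h : Agree σ i j n) :
    Agree σ (shift i) (shift j) (_root_.shift (i + n) - _root_.shift i) ∧
      _root_.shift (i + n) - _root_.shift i = _root_.shift (j + n) - _root_.shift j := by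
  have hs : ∀ x, subst (x + sgn σ) = (subst x).map (· + sgn σ) := by
    cases σ <;> decide
  rw [agree_iff_fixWindow] at h
  have h1 := (flatMap_fixWindow i n).1
  rw [h, List.flatMap_map] at h1
  simp only [hs] at h1
  rw [← List.map_flatMap, (flatMap_fixWindow j n).1] at h1
  have h2 := congrArg List.length h1
  simp only [List.length_map, length_fixWindow] at h2
  refine ⟨?_, h2.symm⟩
  rw [agree_iff_fixWindow, ← h1, h2]

/-! ### Lengths, first letters and last letters of iterated images. -/

/-- The length of the image of a letter under the `k`-th iterate of the morphism. -/
def blockLength (k : ℕ) (x : Fin 6) : ℕ := (substIter k [x]).length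

theorem blockLength_add_sgn (k : ℕ) (x : Fin 6) (σ : Bool) :
    blockLength k (x + sgn σ) = blockLength k x := by
  cases σ
  · simp [sgn]
  · have := substIter_map_add_three k [x]
    simp only [List.map_cons, List.map_nil] at this
    simp [blockLength, sgn, this]

theorem blockLength_zero (k : ℕ) : blockLength k 0 = narayana k := by
  induction k using narayana.induct with
  | case1 => rfl
  | case2 => rfl
  | case3 => rfl
  | case4 n ih1 ih2 =>
    have h : substIter (n + 3) [0] = substIter (n + 2) [0] ++ (substIter n [0]).map (· + 3) := by
      rw [← substIter_map_add_three]
      exact substIter_append n [0, 1, 2] [3]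
    rw [blockLength, h, List.length_append, List.length_map, narayana]
    exact congrArg₂ _ ih1 ih2

theorem blockLength_sgn (k : ℕ) (σ : Bool) : blockLength k (sgn σ) = narayana k := by
  rw [← zero_add (sgn σ), blockLength_add_sgn, blockLength_zero]

theorem blockLength_three (k : ℕ) : blockLength k 3 = narayana k := blockLength_sgn k true

/-- The iterates of `shift`. -/
def shiftIter : ℕ → ℕ → ℕ
  | 0, i => i
  | k + 1, i => shiftIter k (shift i)

theorem shiftIter_add (k l i : ℕ) : shiftIter (k + l) i = shiftIter k (shiftIter l i) := by
  induction l generalizing i with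
  | zero => rfl
  | succ l ih => exact ih _

theorem shiftIter_zero_right (k : ℕ) : shiftIter k 0 = 0 := by
  induction k with
  | zero => rfl
  | succ k ih => exact ih

theorem shiftIter_strictMono (k : ℕ) : StrictMono (shiftIter k) := by
  induction k with
  | zero => exact fun _ _ h => h
  | succ k ih => exact ih.comp shift_strictMono

theorem shiftIter_succ (k i : ℕ) :
    shiftIter k (i + 1) = shiftIter k i + blockLength k (fixWord i) := by
  induction k generalizing i with
  | zero => rfl
  | succ k ih =>
    by_cases h : fixWord i = 0 ∨ fixWord i = 3
    · have h1 : blockLength (k + 1) (fixWord i) =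
          blockLength k (fixWord i) + blockLength k (fixWord i + 1) := by
        have := substIter_append k [fixWord i] [fixWord i + 1]
        simp [blockLength, substIter, subst, h] at this ⊢
        rw [this, List.length_append]
      rw [shiftIter, shift_succ_of_two h, ih, ih, fixWord_shift_add_one h, fixWord_shift,
        substHead, if_pos h, h1, shiftIter, add_assoc]
    · rw [shiftIter, shift_succ_of_one h, ih, fixWord_shift, substHead, if_neg h, shiftIter]
      simp [blockLength, substIter, subst, h]

theorem Agree.shiftIter {σ : Bool} {i j n : ℕ} (h : Agree σ i j n) (k : ℕ) :
    Agree σ (shiftIter k i) (shiftIter k j) (_root_.shiftIter k (i + n) - _root_.shiftIter k i) ∧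
      _root_.shiftIter k (i + n) - _root_.shiftIter k i =
        _root_.shiftIter k (j + n) - _root_.shiftIter k j := by
  induction k generalizing i j n with
  | zero => simpa [_root_.shiftIter] using h
  | succ k ih =>
    obtain ⟨h1, h2⟩ := h.shift
    have h3 := ih h1
    have h4 := shift_strictMono.monotone (Nat.le_add_right i n)
    have h5 := shift_strictMono.monotone (Nat.le_add_right j n)
    rw [Nat.add_sub_cancel' h4, h2, Nat.add_sub_cancel' h5] at h3
    exact h3

theorem fixWord_shiftIter (k i : ℕ) : fixWord (shiftIter k i) = substHead^[k] (fixWord i) := by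
  induction k generalizing i with
  | zero => rfl
  | succ k ih => rw [shiftIter, ih, fixWord_shift, Function.iterate_succ_apply]

/-- The residue of a natural number, as a letter. -/
def residue (k : ℕ) : Fin 6 := ⟨k % 6, Nat.mod_lt _ (by norm_num)⟩

theorem residue_succ (k : ℕ) : residue (k + 1) = 1 + residue k := by
  refine Fin.ext ?_
  simp only [residue, Fin.val_add, Fin.val_one]
  omega

/-- Each application of φ adds 1 to the last letter of an image, so the letter in front of an
iterated image depends only on k mod 6. -/
theorem fixWord_shiftIter_succ_sub_one (k i : ℕ) :
    fixWord (shiftIter k (i + 1) - 1) = fixWord i + residue k := by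
  induction k generalizing i with
  | zero => exact (add_zero _).symm
  | succ k ih =>
    have h : 0 < shift (i + 1) := (Nat.zero_le _).trans_lt (shift_strictMono (Nat.lt_succ_self i))
    obtain ⟨j, hj⟩ := Nat.exists_eq_succ_of_ne_zero h.ne'
    have h2 := fixWord_shift_succ_sub_one i
    rw [hj, Nat.succ_sub_one] at h2
    rw [shiftIter, hj, Nat.succ_eq_add_one, ih, h2, residue_succ, add_assoc]

theorem substHead_iterate_sgn (k : ℕ) (σ : Bool) : substHead^[k] (sgn σ) = sgn σ :=
  Function.iterate_fixed (by revert σ; decide) k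

/-- Taking first letters of images moves 1 to 2 to 3 and then fixes 3. These three letters have the
same code. -/
theorem code_substHead_iterate_one (k : ℕ) (σ : Bool) :
    code (substHead^[k] (1 + sgn σ)) = !σ := by
  have h : ∀ x : Fin 6, (x = 1 + sgn σ ∨ x = 2 + sgn σ ∨ x = 3 + sgn σ) →
      code (substHead^[k] x) = !σ := by
    induction k with
    | zero => cases σ <;> decide
    | succ k ih =>
      intro x hx
      rw [Function.iterate_succ_apply]
      refine ih _ ?_
      revert x
      cases σ <;> decide
  exact h _ (Or.inl rfl)

theorem code_substHead_iterate_four (k : ℕ) (σ : Bool) :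
    code (substHead^[k] (4 + sgn σ)) = σ := by
  have := code_substHead_iterate_one k (!σ)
  have h4 : (4 : Fin 6) + sgn σ = 1 + sgn (!σ) := by clear this; revert σ; decide
  rw [h4, this, Bool.not_not]

theorem code_sgn (σ : Bool) : code (sgn σ) = σ := by revert σ; decide

/-! ### Left special factors of the fixed point -/

/-- The occurrences from which all pairs of occurrences of a left special factor arise: at `p`
a word `x 0 1`, and at `q` a word `5 0 0` or `5 0 3` with `x ≠ 5`, all up to the sign `σ`. -/
structure IsBasePair (σ : Bool) (p q : ℕ) : Prop where
  left_ne : fixWord p ≠ 5 + sgn σ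
  fst : fixWord (p + 1) = sgn σ
  snd : fixWord (p + 2) = 1 + sgn σ
  left : fixWord q = 5 + sgn σ
  fst' : fixWord (q + 1) = sgn σ
  snd' : fixWord (q + 2) = sgn σ ∨ fixWord (q + 2) = 3 + sgn σ

theorem shift_pos_iff {i : ℕ} : 0 < shift i ↔ 0 < i := by
  rw [← shift_strictMono.lt_iff_lt (a := 0) (b := i), shift_zero]

theorem sgn_eq (σ : Bool) : sgn σ = 0 ∨ sgn σ = 3 := by revert σ; decide

theorem mem_of_substHead_eq {σ : Bool} {x : Fin 6} (h : substHead x = sgn σ) :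
    x ∈ [sgn σ, 5 + sgn σ] := by
  revert x σ; decide

theorem add_one_ne_sgn {σ : Bool} {x : Fin 6} (hx : x = 0 ∨ x = 3) : x + 1 ≠ sgn σ := by
  revert x σ; decide

theorem five_add_sgn_ne (σ : Bool) : ¬(5 + sgn σ = 0 ∨ 5 + sgn σ = 3) := by revert σ; decide

theorem substHead_five_add_sgn (σ : Bool) : substHead (5 + sgn σ) = sgn σ := by
  revert σ; decide

theorem substHead_sgn (σ : Bool) : substHead (sgn σ) = sgn σ := by revert σ; decide

theorem substHead_three_add_sgn (σ : Bool) : substHead (3 + sgn σ) = 3 + sgn σ := by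
  revert σ; decide

/-- A letter b other than 0 and 3 is always preceded by b - 1, so the common letter is `sgn σ`. It
cannot be the second letter of an image, these being 1 and 4; hence it begins the image of `sgn σ`
or of 5 + `sgn σ`. The letters in front end the preceding images, so their preimages differ as well.
-/
theorem exists_shift_of_left_special {i j : ℕ} (h : fixWord i ≠ fixWord j)
    (h' : fixWord (i + 1) = fixWord (j + 1)) :
    ∃ σ i' j', i' < i ∧ shift (i' + 1) = i + 1 ∧ shift (j' + 1) = j + 1 ∧
      fixWord i' ≠ fixWord j' ∧ fixWord (i' + 1) ∈ [sgn σ, 5 + sgn σ] ∧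
      fixWord (j' + 1) ∈ [sgn σ, 5 + sgn σ] := by
  have hloc : ∀ p, (fixWord (p + 1) ≠ 0 ∧ fixWord (p + 1) ≠ 3) →
      fixWord p = fixWord (p + 1) - 1 :=
    fixWord_window_five (Q := fun a b _ _ _ => (b ≠ 0 ∧ b ≠ 3) → a = b - 1) (by decide +kernel)
  obtain ⟨σ, hσ⟩ : ∃ σ, fixWord (i + 1) = sgn σ := by
    by_contra hc
    have hne : fixWord (i + 1) ≠ 0 ∧ fixWord (i + 1) ≠ 3 :=
      ⟨fun e => hc ⟨false, e⟩, fun e => hc ⟨true, e⟩⟩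
    refine h ?_
    rw [hloc i hne, hloc j (h' ▸ hne), h']
  have key : ∀ m, fixWord (m + 1) = sgn σ → ∃ m', m' < m ∧ shift (m' + 1) = m + 1 ∧
      fixWord (m' + 1) ∈ [sgn σ, 5 + sgn σ] ∧ fixWord m = fixWord m' + 1 := by
    intro m hm
    obtain ⟨r, -, hr | ⟨hr, hr'⟩⟩ := exists_shift (m + 1)
    · have h0 : 0 < r := shift_pos_iff.1 (by omega)
      obtain ⟨m', rfl⟩ := Nat.exists_eq_succ_of_ne_zero h0.ne'
      have h1 := fixWord_shift (m' + 1)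
      have h2 := fixWord_shift_succ_sub_one m'
      rw [← Nat.succ_eq_add_one, ← hr] at h1 h2
      rw [hm] at h1
      refine ⟨m', ?_, hr.symm, ?_, h2⟩
      · have h4 : ∀ d, d + 2 ≤ shift (d + 1) := by
          intro d
          induction d with
          | zero => decide
          | succ d ih => have := shift_strictMono (Nat.lt_succ_self (d + 1)); simp at this; omega
        have := h4 m'
        simp only [Nat.succ_eq_add_one] at hr
        omega
      · simp only [Nat.succ_eq_add_one] at h1
        exact mem_of_substHead_eq h1.symm
    · exfalso
      have h1 := fixWord_shift_add_one hr'
      rw [← hr, hm] at h1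
      exact add_one_ne_sgn hr' h1.symm
  obtain ⟨i', hi1, hi2, hi3, hi4⟩ := key i hσ
  obtain ⟨j', hj1, hj2, hj3, hj4⟩ := key j (h' ▸ hσ)
  exact ⟨σ, i', j', hi1, hi2, hj2, fun e => h (by rw [hi4, hj4, e]), hi3, hj3⟩

/-- Up to sign, 5 is preceded by 4 and followed by 0 or 3. So 45 followed by 0 or 3 maps to a word
beginning with 500 or 503, while y0 with y ≠ 4 maps to a word ending in x01 with x = y + 1 ≠ 5. -/
theorem isBasePair_shift {σ : Bool} {i j : ℕ} (h : fixWord i ≠ fixWord j)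
    (hi : fixWord (i + 1) = sgn σ) (hj : fixWord (j + 1) = 5 + sgn σ) :
    IsBasePair σ (shift (i + 1) - 1) (shift (j + 1) - 1) := by
  have h1 : ∀ m, shift (m + 1) - 1 + 1 = shift (m + 1) := fun m =>
    Nat.sub_add_cancel (shift_pos_iff.2 m.succ_pos)
  have h2 : ∀ m, shift (m + 1) - 1 + 2 = shift (m + 1) + 1 := fun m => congrArg (· + 1) (h1 m)
  have hloc : ∀ p, ∀ τ, fixWord (p + 1) = 5 + sgn τ →
      fixWord p = 4 + sgn τ ∧ (fixWord (p + 2) = sgn τ ∨ fixWord (p + 2) = 3 + sgn τ) :=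
    fixWord_window_five (Q := fun a b c _ _ => ∀ τ, b = 5 + sgn τ →
      a = 4 + sgn τ ∧ (c = sgn τ ∨ c = 3 + sgn τ)) (by decide +kernel)
  obtain ⟨h3, h4⟩ := hloc j σ hj
  have h03 : fixWord (i + 1) = 0 ∨ fixWord (i + 1) = 3 := hi ▸ sgn_eq σ
  have h03' : ¬(fixWord (j + 1) = 0 ∨ fixWord (j + 1) = 3) := hj ▸ five_add_sgn_ne σ
  have h45 : (4 : Fin 6) + sgn σ + 1 = 5 + sgn σ := add_right_comm _ _ _
  refine ⟨?_, ?_, ?_, ?_, ?_, ?_⟩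
  · rw [fixWord_shift_succ_sub_one, ← h45, ← h3]
    exact fun e => h (add_right_cancel e)
  · rw [h1, fixWord_shift, hi, substHead_sgn]
  · rw [h2, fixWord_shift_add_one h03, hi, add_comm]
  · rw [fixWord_shift_succ_sub_one, h3, h45]
  · rw [h1, fixWord_shift, hj, substHead_five_add_sgn]
  · rw [h2, ← shift_succ_of_one h03', fixWord_shift]
    change fixWord (j + 1 + 1) = _ ∨ fixWord (j + 1 + 1) = _ at h4
    rcases h4 with h4 | h4 <;> rw [h4]
    · exact Or.inl (substHead_sgn σ)
    · exact Or.inr (substHead_three_add_sgn σ)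

/-- Desubstitution strictly decreases the first position, so it stops, and it can stop only at two
different preimages, 0 and 5 up to sign. Either occurrence may be the one with 0, hence the two
alternatives. -/
theorem exists_isBasePair {i j : ℕ} (h : fixWord i ≠ fixWord j)
    (h' : fixWord (i + 1) = fixWord (j + 1)) :
    ∃ k σ p q, IsBasePair σ p q ∧
      (shiftIter k (p + 1) = i + 1 ∧ shiftIter k (q + 1) = j + 1 ∨
        shiftIter k (p + 1) = j + 1 ∧ shiftIter k (q + 1) = i + 1) := by
  induction i using Nat.strong_induction_on generalizing j with
  | _ i ih =>
    obtain ⟨σ, i', j', hlt, hi, hj, hne, hi', hj'⟩ := exists_shift_of_left_special h h'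
    have hs : ∀ m, shift (m + 1) - 1 + 1 = shift (m + 1) := fun m =>
      Nat.sub_add_cancel (shift_pos_iff.2 m.succ_pos)
    by_cases heq : fixWord (i' + 1) = fixWord (j' + 1)
    · obtain ⟨k, τ, p, q, hb, hpq⟩ := ih i' hlt hne heq
      have hk : ∀ m, shiftIter (k + 1) m = shift (shiftIter k m) := fun m => by
        rw [add_comm, shiftIter_add]; rfl
      refine ⟨k + 1, τ, p, q, hb, ?_⟩
      rw [hk, hk]
      rcases hpq with ⟨h1, h2⟩ | ⟨h1, h2⟩
      · exact Or.inl (by rw [h1, h2, hi, hj]; exact ⟨rfl, rfl⟩)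
      · exact Or.inr (by rw [h1, h2, hi, hj]; exact ⟨rfl, rfl⟩)
    · simp only [List.mem_cons, List.not_mem_nil, or_false] at hi' hj'
      rcases hi' with h1 | h1 <;> rcases hj' with h2 | h2
      · exact absurd (h1.trans h2.symm) heq
      · exact ⟨0, σ, _, _, isBasePair_shift hne h1 h2, Or.inl ⟨by rw [hs]; exact hi, by rw [hs]; exact hj⟩⟩
      · exact ⟨0, σ, _, _, isBasePair_shift hne.symm h2 h1, Or.inr ⟨by rw [hs]; exact hj, by rw [hs]; exact hi⟩⟩
      · exact absurd (h1.trans h2.symm) heq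

theorem shiftIter_succ_of_sgn {σ : Bool} {i : ℕ} (h : fixWord i = sgn σ) (k : ℕ) :
    shiftIter k (i + 1) = shiftIter k i + narayana k := by
  rw [shiftIter_succ, h, blockLength_sgn]

theorem Agree.shiftIter_one {σ τ : Bool} {i j : ℕ} (hi : fixWord i = sgn σ)
    (h : fixWord i = fixWord j + sgn τ) (k : ℕ) :
    Agree τ (_root_.shiftIter k i) (_root_.shiftIter k j) (narayana k) := by
  have := ((agree_one h).shiftIter k).1
  rwa [shiftIter_succ_of_sgn hi, Nat.add_sub_cancel_left] at this

theorem narayana_two_add (k : ℕ) : narayana (k + 2) + narayana k = narayana (k + 3) := rfl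

theorem three_add_sgn (σ : Bool) : 3 + sgn σ = sgn (!σ) := by revert σ; decide

theorem substHead_iterate_ne (k : ℕ) (σ : Bool) (hk : k < 2) :
    substHead^[k] (sgn σ) ≠ substHead^[k] (4 + sgn σ) := by
  interval_cases k <;> revert σ <;> decide

namespace IsBasePair

variable {σ : Bool} {p q : ℕ}

theorem agree_narayana (hb : IsBasePair σ p q) (k : ℕ) :
    Agree false (shiftIter k (p + 1)) (shiftIter k (q + 1)) (narayana k) :=
  Agree.shiftIter_one hb.fst (by rw [hb.fst, hb.fst']; simp [sgn]) k

theorem shiftIter_add_narayana (hb : IsBasePair σ p q) (k : ℕ) :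
    shiftIter k (p + 1) + narayana k = shiftIter k (p + 2) ∧
      shiftIter k (q + 1) + narayana k = shiftIter k (q + 2) :=
  ⟨(shiftIter_succ_of_sgn hb.fst k).symm, (shiftIter_succ_of_sgn hb.fst' k).symm⟩

/-- The continuation of the second occurrence after two steps, if the signs differ. -/
theorem snd_window (h : fixWord (q + 2) = 3 + sgn σ) :
    fixWord (shiftIter 2 (q + 2)) = 3 + sgn σ ∧
      fixWord (shiftIter 2 (q + 2) + 1) = 4 + sgn σ ∧
      fixWord (shiftIter 2 (q + 2) + 2) = 5 + sgn σ := by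
  have h1 : fixWord (q + 2) = fixWord 0 + sgn (!σ) := by
    rw [h, three_add_sgn, fixWord_zero, zero_add]
  have h2 := Agree.shiftIter_one (h.trans (three_add_sgn σ)) h1 2
  have h3 : (sgn !σ) = 3 + sgn σ := (three_add_sgn σ).symm
  have h4 := h2 0 (by decide)
  have h5 := h2 1 (by decide)
  have h6 := h2 2 (by decide)
  have e0 : fixWord (shiftIter 2 0 + 0) = 0 := by decide
  have e1 : fixWord (shiftIter 2 0 + 1) = 1 := by decide
  have e2 : fixWord (shiftIter 2 0 + 2) = 2 := by decide
  rw [h3, e0] at h4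
  rw [h3, e1] at h5
  rw [h3, e2] at h6
  refine ⟨by simpa using h4, ?_, ?_⟩
  · rw [h5, ← add_assoc]; rfl
  · rw [h6, ← add_assoc]; rfl

/-- Since φ²(1) = 3 and φ²(3) = 345, the images of 01 and 03 share φ^{k+2}(0) φ^k(3), of length
N_{k+2} + N_k = N_{k+3}. -/
theorem agree_narayana_succ (hb : IsBasePair σ p q) (h : fixWord (q + 2) = 3 + sgn σ) (k : ℕ) :
    Agree false (shiftIter (k + 2) (p + 1)) (shiftIter (k + 2) (q + 1)) (narayana (k + 3)) ∧
      shiftIter (k + 2) (p + 1) + narayana (k + 3) = shiftIter k (shiftIter 2 (p + 3)) ∧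
      shiftIter (k + 2) (q + 1) + narayana (k + 3) = shiftIter k (shiftIter 2 (q + 2) + 1) := by
  obtain ⟨h1, h2⟩ := hb.shiftIter_add_narayana (k + 2)
  have h3 : fixWord (shiftIter 2 (p + 2)) = sgn (!σ) := by
    rw [fixWord_shiftIter, hb.snd]; clear * -; revert σ; decide
  have h4 := (snd_window h).1.trans (three_add_sgn σ)
  have h5 : shiftIter 2 (p + 3) = shiftIter 2 (p + 2) + 1 := by
    rw [shiftIter_succ, hb.snd, blockLength_add_sgn]; rfl
  rw [shiftIter_add k 2] at h1 h2
  rw [shiftIter_add k 2, shiftIter_add k 2, ← narayana_two_add, ← add_assoc, ← add_assoc]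
  rw [shiftIter_add k 2 (p + 2)] at h1
  rw [shiftIter_add k 2 (q + 2)] at h2
  rw [h1, h2, h5, shiftIter_succ_of_sgn h3, shiftIter_succ_of_sgn h4]
  refine ⟨?_, rfl, rfl⟩
  have h6 := hb.agree_narayana (k + 2)
  rw [shiftIter_add k 2, shiftIter_add k 2] at h6
  refine h6.append ?_
  rw [h1, h2]
  exact Agree.shiftIter_one h3 (by rw [h3, h4]; simp [sgn]) k

theorem fst_letter (h : fixWord (p + 3) = sgn σ) (k : ℕ) :
    fixWord (shiftIter (k + 2) (shiftIter 2 (p + 3))) = sgn σ := by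
  rw [fixWord_shiftIter, fixWord_shiftIter, h, substHead_iterate_sgn, substHead_iterate_sgn]

/-- After the common part of `agree_narayana_succ`, images of 012 (from the 0 that follows 01) meet
images of 45. As φ²(0) = 012 and φ²(45) = 001, they share one more φ^k(0), and then 1 stands against
0. -/
theorem agree_long (hb : IsBasePair σ p q) (h : fixWord (q + 2) = 3 + sgn σ)
    (h' : fixWord (p + 3) = sgn σ) (k : ℕ) :
    Agree false (shiftIter (k + 4) (p + 1)) (shiftIter (k + 4) (q + 1))
        (narayana (k + 5) + narayana k) ∧
      code (fixWord (shiftIter (k + 4) (p + 1) + (narayana (k + 5) + narayana k))) = !σ ∧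
      code (fixWord (shiftIter (k + 4) (q + 1) + (narayana (k + 5) + narayana k))) = σ := by
  obtain ⟨h1, h2, h3⟩ := hb.agree_narayana_succ h (k + 2)
  obtain ⟨h4, h5, h6⟩ := snd_window h
  set p' := shiftIter 2 (p + 3)
  set q' := shiftIter 2 (q + 2) + 1 with hq'
  have h7 : fixWord (shiftIter 2 p') = sgn σ := fst_letter (k := 0) h'
  have h8 : fixWord (shiftIter 2 q') = sgn σ := by
    rw [fixWord_shiftIter, h5]; clear * -; revert σ; decide
  rw [shiftIter_add k 2] at h2 h3
  have h9 : fixWord (shiftIter 2 p' + 1) = 1 + sgn σ := by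
    have := Agree.shiftIter_one (i := p') (j := 0) (σ := σ) (τ := σ)
      (by rw [fixWord_shiftIter, h', substHead_iterate_sgn])
      (by rw [fixWord_shiftIter, h', substHead_iterate_sgn, fixWord_zero, zero_add]) 2 1 (by decide)
    rw [this]; rfl
  have h10 : fixWord (shiftIter 2 q' + 1) = sgn σ := by
    have : shiftIter 2 (q' + 1) = shiftIter 2 q' + 1 := by
      rw [shiftIter_succ, h5, blockLength_add_sgn]; rfl
    rw [← this, fixWord_shiftIter]
    change substHead^[2] (fixWord (shiftIter 2 (q + 2) + 2)) = _
    rw [h6]; clear * -; revert σ; decide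
  rw [← add_assoc, ← add_assoc, show k + 4 = k + 2 + 2 from rfl, show k + 5 = k + 2 + 3 from rfl,
    h2, h3, ← shiftIter_succ_of_sgn h7, ← shiftIter_succ_of_sgn h8]
  refine ⟨h1.append ?_, ?_, ?_⟩
  · rw [h2, h3]
    exact Agree.shiftIter_one h7 (by rw [h7, h8]; simp [sgn]) k
  · rw [fixWord_shiftIter, h9, code_substHead_iterate_one]
  · rw [fixWord_shiftIter, h10, substHead_iterate_sgn, code_sgn]

/-- The first mismatch after the images of the two occurrences of a base pair. -/
theorem exists_mismatch (hb : IsBasePair σ p q) (k : ℕ) :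
    ∃ L, Agree false (shiftIter k (p + 1)) (shiftIter k (q + 1)) L ∧
      fixWord (shiftIter k (p + 1) + L) ≠ fixWord (shiftIter k (q + 1) + L) ∧
      (7 ≤ L → code (fixWord (shiftIter k (p + 1) + L)) ≠
        code (fixWord (shiftIter k (q + 1) + L))) ∧
      (L ≤ narayana (k + 1) ∨ ∃ m, k = m + 4 ∧ L = narayana (m + 5) + narayana m ∧
        fixWord p = sgn σ ∧ fixWord (q + 2) = 3 + sgn σ) := by
  have of_code : ∀ {x y : Fin 6}, code x ≠ code y → x ≠ y := fun h e => h (congrArg code e)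
  obtain ⟨h1, h2⟩ := hb.shiftIter_add_narayana k
  rcases hb.snd' with h | h
  -- For 500, images of 1 and 0 follow the common image of 0, and their codes differ at once.
  · have hc : code (fixWord (shiftIter k (p + 1) + narayana k)) ≠
        code (fixWord (shiftIter k (q + 1) + narayana k)) := by
      rw [h1, h2, fixWord_shiftIter, fixWord_shiftIter, hb.snd, h, substHead_iterate_sgn,
        code_substHead_iterate_one, code_sgn]
      simp
    exact ⟨_, hb.agree_narayana k, of_code hc, fun _ => hc,
      Or.inl (narayana_strictMono (Nat.lt_succ_self k)).le⟩
  -- For 503 and small k the letters differ, but their codes need not: 1 and 3 have the same code.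
  by_cases hk : k < 2
  · refine ⟨_, hb.agree_narayana k, ?_, fun h7 => ?_, Or.inl (narayana_strictMono (Nat.lt_succ_self k)).le⟩
    · rw [h1, h2, fixWord_shiftIter, fixWord_shiftIter, hb.snd, h]
      clear * - hk
      interval_cases k <;> revert σ <;> decide
    · have := narayana_strictMono hk
      have h2 : narayana 2 = 3 := rfl
      omega
  obtain ⟨k, rfl⟩ := Nat.exists_eq_add_of_le' (not_lt.1 hk)
  obtain ⟨h3, h4, h5⟩ := hb.agree_narayana_succ h k
  have h6 := (snd_window h).2.1
  have hloc : ∀ p, ∀ σ, (fixWord (p + 1) = sgn σ ∧ fixWord (p + 2) = 1 + sgn σ) →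
      ((fixWord (p + 3) = sgn σ ∧ (fixWord p = sgn σ ∨ fixWord p = 5 + sgn σ)) ∨
        fixWord (p + 3) = 2 + sgn σ ∨ fixWord (p + 3) = 3 + sgn σ) :=
    fixWord_window_five (Q := fun a b c d _ => ∀ σ, (b = sgn σ ∧ c = 1 + sgn σ) →
      ((d = sgn σ ∧ (a = sgn σ ∨ a = 5 + sgn σ)) ∨ d = 2 + sgn σ ∨ d = 3 + sgn σ))
      (by decide +kernel)
  rcases hloc p σ ⟨hb.fst, hb.snd⟩ with ⟨h7, h8⟩ | h7
  · have h8 : fixWord p = sgn σ := h8.resolve_right hb.left_ne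
    -- Here 0 meets 4 or 5, letters with the same code. This happens at length at most N_4 = 6,
    -- whence the bound 7.
    by_cases hk2 : k < 2
    · refine ⟨_, h3, ?_, fun h7 => ?_, Or.inl le_rfl⟩
      · rw [h4, h5, fixWord_shiftIter, fixWord_shiftIter, fixWord_shiftIter, h6, h7,
          substHead_iterate_sgn]
        exact substHead_iterate_ne k σ hk2
      · have := narayana_strictMono.monotone (show k + 3 ≤ 4 by omega)
        have h2 : narayana 4 = 6 := rfl
        omega
    obtain ⟨m, rfl⟩ := Nat.exists_eq_add_of_le' (not_lt.1 hk2)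
    obtain ⟨h9, h10, h11⟩ := hb.agree_long h h7 m
    have hc : ∀ {x y : Bool}, x = !σ → y = σ → x ≠ y := by rintro _ _ rfl rfl; simp
    exact ⟨_, h9, of_code (hc h10 h11), fun _ => hc h10 h11, Or.inr ⟨m, rfl, rfl, h8, h⟩⟩
  -- If 01 is followed by 2 or 3, its second image begins with 3, against the 4 of the other
  -- occurrence.
  · have h8 : substHead^[2] (fixWord (p + 3)) = 3 + sgn σ := by
      rcases h7 with h7 | h7 <;> rw [h7] <;> clear * - <;> revert σ <;> decide
    have hc : code (fixWord (shiftIter (k + 2) (p + 1) + narayana (k + 3))) ≠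
        code (fixWord (shiftIter (k + 2) (q + 1) + narayana (k + 3))) := by
      rw [h4, h5, fixWord_shiftIter, fixWord_shiftIter, fixWord_shiftIter, h6, h8, three_add_sgn,
        substHead_iterate_sgn, code_sgn, code_substHead_iterate_four]
      simp
    exact ⟨_, h3, of_code hc, fun _ => hc, Or.inl le_rfl⟩

/-- Up to sign, φ^k(01) = φ^{k+1}(0) is the prefix of length N_{k+1}. -/
theorem agree_zero (hb : IsBasePair σ p q) (k : ℕ) :
    Agree σ (shiftIter k (p + 1)) 0 (narayana (k + 1)) := by
  have h : Agree σ (p + 1) 0 2 := agree_two (by rw [hb.fst, fixWord_zero, zero_add])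
    (by rw [show p + 1 + 1 = p + 2 from rfl, hb.snd]; rfl)
  have h1 := (h.shiftIter k).1
  rw [(h.shiftIter k).2, shiftIter_zero_right, Nat.sub_zero, zero_add] at h1
  have h2 : shiftIter k 2 = narayana (k + 1) := by
    have h3 : shiftIter (k + 1) 1 = shiftIter (k + 1) 0 + narayana (k + 1) :=
      shiftIter_succ_of_sgn (σ := false) rfl (k + 1)
    rw [shiftIter_zero_right, zero_add] at h3
    rw [← h3]; rfl
  rwa [h2] at h1

/-- The position `12` of the fixed point starts with `0 3`, after a `5`. -/
theorem agree_twelve (hb : IsBasePair σ p q) (h : fixWord (q + 2) = 3 + sgn σ) (k : ℕ) :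
    Agree σ (shiftIter (k + 4) (q + 1)) (shiftIter (k + 4) 12)
      (narayana (k + 5) + narayana k) := by
  have e0 : fixWord 12 = 0 := by decide +kernel
  have e1 : fixWord 13 = 3 := by decide +kernel
  have h0 : Agree σ (q + 1) 12 2 := agree_two (by rw [hb.fst', e0, zero_add])
    (by rw [show q + 1 + 1 = q + 2 from rfl, h, e1])
  obtain ⟨h1, h2⟩ := h0.shiftIter (k + 4)
  refine h1.mono ?_
  rw [h2, show 12 + 2 = 12 + 1 + 1 from rfl, shiftIter_succ, shiftIter_succ, e0, e1,
    blockLength_zero, blockLength_three]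
  -- The image of 03 has length 2N_{k+4}, which exceeds N_{k+5} + N_k because N_{k+4} = N_{k+3} +
  -- N_{k+1}.
  have h3 : narayana (k + 5) = narayana (k + 4) + narayana (k + 2) := rfl
  have h4 : narayana (k + 4) = narayana (k + 3) + narayana (k + 1) := rfl
  have h5 := narayana_strictMono (show k + 2 < k + 3 by omega)
  have h6 := narayana_strictMono (show k < k + 1 by omega)
  omega

end IsBasePair

/-- A long left special factor of the fixed point, with its maximal common extension to the
right: up to sign it is a prefix of the fixed point, or else belongs to a sequence of words. -/
theorem exists_mismatch_of_left_special {i j n : ℕ} (h : fixWord i ≠ fixWord j)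
    (hn : Agree false (i + 1) (j + 1) n) (h7 : 7 ≤ n) :
    ∃ L σ, code (fixWord (i + 1 + L)) ≠ code (fixWord (j + 1 + L)) ∧ Agree false (i + 1) (j + 1) L ∧
      (Agree σ (i + 1) 0 L ∨ ∃ m, L = narayana (m + 5) + narayana m ∧
        Agree σ (i + 1) 0 (narayana (m + 5)) ∧ Agree σ (i + 1) (shiftIter (m + 4) 12) L ∧
        (fixWord i = sgn σ + residue (m + 4) ∧ fixWord j = 5 + sgn σ + residue (m + 4) ∨
          fixWord j = sgn σ + residue (m + 4) ∧ fixWord i = 5 + sgn σ + residue (m + 4))) := by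
  obtain ⟨k, σ, p, q, hb, hpq⟩ := exists_isBasePair h (by simpa [sgn] using hn 0 (by omega))
  obtain ⟨L, h1, h2, h3, h4⟩ := hb.exists_mismatch k
  have hz := hb.agree_zero k
  have hp := fixWord_shiftIter_succ_sub_one k p
  have hq := fixWord_shiftIter_succ_sub_one k q
  have hL : 7 ≤ L := by
    by_contra hlt
    rcases hpq with ⟨h5, h6⟩ | ⟨h5, h6⟩ <;> rw [h5, h6] at h2
    · exact h2 (by simpa [sgn] using hn L (by omega))
    · exact h2 (by simpa [sgn] using (hn L (by omega)).symm)
  have h3 := h3 hL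
  refine ⟨L, σ, ?_⟩
  rcases h4 with h4 | ⟨m, rfl, hm, hp', hq'⟩
  · have h8 := hz.mono h4
    rcases hpq with ⟨h5, h6⟩ | ⟨h5, h6⟩ <;> rw [h5, h6] at h1 h3 <;> rw [h5] at h8
    · exact ⟨h3, h1, Or.inl h8⟩
    · exact ⟨h3.symm, h1.symm_false, Or.inl (h1.symm_false.trans_false h8)⟩
  · have h9 := hb.agree_twelve hq' m
    rw [← hm] at h9
    have hmono : narayana (m + 5) ≤ L := by omega
    rw [hp'] at hp
    rw [hb.left] at hq
    rcases hpq with ⟨h5, h6⟩ | ⟨h5, h6⟩ <;> rw [h5, h6] at h1 h3 <;> rw [h5] at hz hp <;>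
      rw [h6] at h9 hq <;> rw [Nat.add_sub_cancel] at hp hq
    · exact ⟨h3, h1, Or.inr ⟨m, hm, hz, h1.trans_false h9, Or.inl ⟨hp, hq⟩⟩⟩
    · exact ⟨h3.symm, h1.symm_false,
        Or.inr ⟨m, hm, (h1.mono hmono).symm_false.trans_false hz, h9, Or.inr ⟨hp, hq⟩⟩⟩

/-! ### Left special factors of the Allouche–Johnson word -/

/-- The code of the letter before a letter that is followed by `0` or `3`. -/
def prevCode (x : Fin 6) : Bool := x == 2 || x == 3 || x == 4

theorem code_eq_prevCode (p : ℕ) (σ : Bool) (h : fixWord (p + 2) = sgn σ) :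
    code (fixWord p) = prevCode (fixWord (p + 1)) := by
  have : ∀ p, ∀ σ, fixWord (p + 2) = sgn σ → code (fixWord p) = prevCode (fixWord (p + 1)) :=
    fixWord_window_five (Q := fun a b c _ _ => ∀ σ, c = sgn σ → code a = prevCode b)
      (by decide +kernel)
  exact this p σ h

/-- The letters `x` and `y` in front of two occurrences of a word starting with `0` or `3` are
such that exactly the codes of `e` letters before the two occurrences agree. -/
def CodesSplit (e : ℕ) (x y : Fin 6) : Prop :=
  e = 0 ∧ code x ≠ code y ∨ e = 1 ∧ code x = code y ∧ prevCode x ≠ prevCode y ∨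
    e = 2 ∧ code x = code y ∧ prevCode x = prevCode y ∧ x ≠ y

instance (e : ℕ) (x y : Fin 6) : Decidable (CodesSplit e x y) := by
  unfold CodesSplit; infer_instance

theorem CodesSplit.unique {e e' : ℕ} {x y : Fin 6} (h : CodesSplit e x y)
    (h' : CodesSplit e' x y) : e = e' := by
  unfold CodesSplit at *; grind

theorem CodesSplit.symm {e : ℕ} {x y : Fin 6} (h : CodesSplit e x y) : CodesSplit e y x := by
  unfold CodesSplit at *; grind

theorem CodesSplit.code_eq {e : ℕ} {x y : Fin 6} (h : CodesSplit e x y) (he : e ≠ 0) :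
    code x = code y := by
  unfold CodesSplit at *; grind

theorem CodesSplit.le_two {e : ℕ} {x y : Fin 6} (h : CodesSplit e x y) : e ≤ 2 := by
  unfold CodesSplit at *; omega

theorem CodesSplit.prevCode_eq {x y : Fin 6} (h : CodesSplit 2 x y) : prevCode x = code x := by
  revert x y; decide

/-- Only m mod 6 matters, so this is a finite check: with r ≡ m + 4 (mod 6), r + 2 ≡ m (mod 3). -/
theorem codesSplit_sgn_add_residue (σ : Bool) (m : ℕ) :
    CodesSplit (m % 3) (sgn σ + residue (m + 4)) (5 + sgn σ + residue (m + 4)) := by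
  have key : ∀ σ, ∀ r : Fin 6, CodesSplit ((r.val + 2) % 3) (sgn σ + r) (5 + sgn σ + r) := by
    decide
  have h := key σ (residue (m + 4))
  rwa [show ((residue (m + 4)).val + 2) % 3 = m % 3 by simp only [residue]; omega] at h

/-- The word `b^e y`, with the sign `σ` on the second part. -/
def leftWord (e : ℕ) (b σ : Bool) (y : ℕ → Bool) (t : ℕ) : Bool :=
  if t < e then b else (y (t - e) ^^ σ)

/-- The exceptional left special words. -/
def extraWord (m : ℕ) (σ : Bool) : ℕ → Bool :=
  leftWord (m % 3) (code (sgn σ + residue (m + 4))) σ fun t =>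
    code (fixWord (shiftIter (m + 4) 12 + t))

/-- Recovering letters from codes costs two positions at either end. Then i + e is the last of i, i
+ 1, i + 2 where the letters still differ; they do differ at i, since the codes do. -/
theorem exists_codesSplit {i j n : ℕ} (h0 : ja i ≠ ja j) (hn : 4 ≤ n)
    (h : ∀ t < n, ja (i + 1 + t) = ja (j + 1 + t)) :
    ∃ e ≤ 2, fixWord (i + e) ≠ fixWord (j + e) ∧
      Agree false (i + e + 1) (j + e + 1) (n - 2 - e) := by
  have h2 : ∀ t < n - 4, fixWord (i + 3 + t) = fixWord (j + 3 + t) := by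
    intro t ht
    have := fixWord_eq_of_code (i + 1 + t) (j + 1 + t) fun s hs => by
      rw [← ja_eq_code, ← ja_eq_code]
      simpa only [add_assoc] using h (t + s) (by omega)
    rwa [show i + 1 + t + 2 = i + 3 + t by omega, show j + 1 + t + 2 = j + 3 + t by omega] at this
  have h3 : Agree false (i + 3) (j + 3) (n - 4) := fun t ht => by
    simpa [sgn] using h2 t ht
  have step : ∀ e m, fixWord (i + e + 1) = fixWord (j + e + 1) →
      Agree false (i + e + 2) (j + e + 2) m → Agree false (i + e + 1) (j + e + 1) (m + 1) := by
    intro e m h4 h5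
    rw [add_comm m 1]
    exact (agree_one (by simpa [sgn] using h4)).append h5
  have hw : fixWord i ≠ fixWord j := fun e => h0 (by rw [ja_eq_code, ja_eq_code, e])
  by_cases e2 : fixWord (i + 2) = fixWord (j + 2)
  · have h4 := step 1 _ e2 h3
    by_cases e1 : fixWord (i + 1) = fixWord (j + 1)
    · exact ⟨0, by omega, hw, (step 0 _ e1 h4).mono (by omega)⟩
    · exact ⟨1, by omega, e1, h4.mono (by omega)⟩
  · exact ⟨2, by omega, e2, h3.mono (by omega)⟩

theorem codesSplit_of_left_special {i j e : ℕ} {σ : Bool} (h0 : ja i ≠ ja j) (he : e ≤ 2)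
    (h : ∀ t < e, ja (i + 1 + t) = ja (j + 1 + t)) (hw : fixWord (i + e) ≠ fixWord (j + e))
    (hi : fixWord (i + e + 1) = sgn σ) (hj : fixWord (j + e + 1) = sgn σ) :
    CodesSplit e (fixWord (i + e)) (fixWord (j + e)) := by
  simp only [ja_eq_code] at h0 h
  have h1 : e = 0 ∨ e = 1 ∨ e = 2 := by omega
  rcases h1 with rfl | rfl | rfl
  · exact Or.inl ⟨rfl, h0⟩
  · refine Or.inr (Or.inl ⟨rfl, h 0 (by omega), ?_⟩)
    rwa [← code_eq_prevCode i σ hi, ← code_eq_prevCode j σ hj]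
  · refine Or.inr (Or.inr ⟨rfl, h 1 (by omega), ?_, hw⟩)
    have := h 0 (by omega)
    rwa [code_eq_prevCode (i + 1) σ hi, code_eq_prevCode (j + 1) σ hj] at this

/-- The e letters in front all have one code, even for e = 2, by `CodesSplit.prevCode_eq`. Hence the
left part is a power b^e. -/
theorem ja_eq_of_codesSplit {i e : ℕ} {σ : Bool} {y : Fin 6}
    (h : CodesSplit e (fixWord (i + e)) y) (hi : fixWord (i + e + 1) = sgn σ) (t : ℕ) (ht : t < e) :
    ja (i + 1 + t) = code (fixWord (i + e)) := by
  rw [ja_eq_code]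
  have h1 : t = 0 ∧ e = 2 ∨ t + 1 = e := by have := h.le_two; omega
  rcases h1 with ⟨rfl, rfl⟩ | rfl
  · rw [← h.prevCode_eq]
    exact code_eq_prevCode (i + 1) σ hi
  · rw [add_right_comm, add_assoc]

/-- With 11 ≤ n and e ≤ 2, at least n - 2 - e ≥ 7 letters of the fixed point are common, as
`exists_mismatch_of_left_special` requires. -/
theorem leftSpecial_ja_subset {n : ℕ} (hn : 11 ≤ n) {u : Fin n → Bool}
    (hu : u ∈ leftSpecial ja n) :
    ∃ σ, (∃ e ≤ 2, ∃ b, u = fun t : Fin n => leftWord e b σ ja t) ∨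
      ∃ m, narayana (m + 5) + m % 3 < n ∧ n ≤ narayana (m + 5) + m % 3 + narayana m ∧
        u = fun t : Fin n => extraWord m σ t := by
  obtain ⟨i, j, h0, rfl, hij⟩ := hu
  have h : ∀ t < n, ja (i + 1 + t) = ja (j + 1 + t) := fun t ht => (congrFun hij ⟨t, ht⟩).symm
  obtain ⟨e, he, hw, ha⟩ := exists_codesSplit h0 (by omega) h
  obtain ⟨L, σ, h1, h2, h3⟩ := exists_mismatch_of_left_special hw ha (by omega)
  have hL : n ≤ e + L := by
    by_contra hlt
    have := h (e + L) (by omega)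
    rw [ja_eq_code, ja_eq_code] at this
    refine h1 ?_
    convert this using 3 <;> omega
  have hL1 : 9 ≤ L := by omega
  have hi : fixWord (i + e + 1) = sgn σ := by
    rcases h3 with h3 | ⟨m, hm, h3, h4⟩
    · simpa [fixWord_zero] using h3 0 (by omega)
    · have : m + 5 ≤ narayana (m + 5) := narayana_strictMono.id_le _
      simpa [fixWord_zero] using h3 0 (by omega)
  have hj : fixWord (j + e + 1) = sgn σ := by
    rw [← hi]; simpa [sgn] using (h2 0 (by omega)).symm
  have hs := codesSplit_of_left_special h0 he (fun t ht => h t (by omega)) hw hi hj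
  have hpre := ja_eq_of_codesSplit hs hi
  have hword : ∀ y M, Agree σ (i + e + 1) y M → n ≤ e + M →
      factorAt ja n (i + 1) = fun t : Fin n => leftWord e (code (fixWord (i + e))) σ
        (fun t => code (fixWord (y + t))) t := by
    intro y M hA hM
    funext t
    have ht := t.2
    simp only [factorAt, leftWord]
    split_ifs with hte
    · exact hpre _ hte
    · rw [ja_eq_code, ← code_add_sgn, ← hA _ (by omega)]
      congr 2; omega
  have hten : ∀ M, Agree σ (i + e + 1) 0 M → n ≤ e + M →
      ∃ e ≤ 2, ∃ b, factorAt ja n (i + 1) = fun t : Fin n => leftWord e b σ ja t := by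
    intro M hA hM
    refine ⟨e, he, code (fixWord (i + e)), (hword 0 M hA hM).trans ?_⟩
    simp only [zero_add, ← ja_eq_code]
  refine ⟨σ, ?_⟩
  rcases h3 with h3 | ⟨m, hm, h3, h4, h5⟩
  · exact Or.inl (hten L h3 hL)
  -- Up to this length an exceptional word has not yet left the prefix of the fixed point.
  rcases le_or_gt n (e + narayana (m + 5)) with h6 | h6
  · exact Or.inl (hten _ h3 h6)
  have hc := codesSplit_sgn_add_residue σ m
  have hem : e = m % 3 := by
    rcases h5 with ⟨h7, h8⟩ | ⟨h7, h8⟩ <;> rw [h7, h8] at hs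
    · exact hs.unique hc
    · exact hs.symm.unique hc
  subst hem
  refine Or.inr ⟨m, by omega, by omega, (hword _ L h4 hL).trans ?_⟩
  funext t
  simp only [extraWord, leftWord]
  split_ifs with hte
  · rcases h5 with ⟨h7, h8⟩ | ⟨h7, h8⟩
    · rw [h7]
    · rw [h7, h8] at hs
      rw [h8, hs.code_eq (by omega)]
  · rfl

/-- The converse construction. The offsets P + 2 and P + 3 leave room for two further letters on the
left, so the occurrence can start at P + (2 - e) + 1. -/
theorem mem_leftSpecial_ja {e P Q L n : ℕ} {σ : Bool} {z : ℕ}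
    (hs : CodesSplit e (fixWord (P + 2)) (fixWord (Q + 2))) (hA : Agree σ (P + 3) z L)
    (hA' : Agree false (P + 3) (Q + 3) L) (hL : 0 < L)
    (hP : fixWord (P + 3) = sgn σ) (hn : n ≤ e + L) :
    (fun t : Fin n => leftWord e (code (fixWord (P + 2))) σ (fun t => code (fixWord (z + t))) t) ∈
      leftSpecial ja n := by
  have hQ : fixWord (Q + 3) = sgn σ := by
    rw [← hP]; simpa [sgn] using (hA' 0 hL).symm
  have he := hs.le_two
  have hword : ∀ R z', fixWord (R + 3) = sgn σ → Agree σ (R + 3) z L →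
      code (fixWord (R + 2)) = code (fixWord (P + 2)) ∨ e = 0 →
      CodesSplit e (fixWord (R + 2)) z' → factorAt ja n (R + (2 - e) + 1) =
        fun t : Fin n => leftWord e (code (fixWord (P + 2))) σ
          (fun t => code (fixWord (z + t))) t := by
    intro R z' hR hRA hc hRs
    funext t
    have ht := t.2
    have e1 : R + (2 - e) + e = R + 2 := by omega
    simp only [factorAt, leftWord]
    split_ifs with hte
    · have h1 : CodesSplit e (fixWord (R + (2 - e) + e)) z' := by rwa [e1]
      rw [ja_eq_of_codesSplit h1 (by rw [e1]; exact hR) _ hte, e1]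
      exact hc.resolve_right (by omega)
    · rw [ja_eq_code, ← code_add_sgn, ← hRA _ (by omega)]
      congr 2; omega
  refine ⟨P + (2 - e), Q + (2 - e), ?_, hword P _ hP hA (Or.inl rfl) hs,
    hword Q _ hQ (hA'.symm_false.trans_false hA) ?_ hs.symm⟩
  -- This serves e = 2, where the codes two places further left must differ. Only 0, 2, 3, 5 occur
  -- in such pairs, and they determine that code. The first alternative never holds.
  · have hloc : ∀ p, ∀ σ, fixWord (p + 3) = sgn σ → CodesSplit 2 (fixWord (p + 2)) (fixWord (p + 2)) ∨
        (fixWord (p + 2) ∈ [0, 5, 2, 3] →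
          code (fixWord p) = (fixWord (p + 2) == 3 || fixWord (p + 2) == 5)) :=
      fixWord_window_five (Q := fun a _ c d _ => ∀ σ, d = sgn σ → CodesSplit 2 c c ∨
        (c ∈ [0, 5, 2, 3] → code a = (c == 3 || c == 5))) (by decide +kernel)
    rw [ja_eq_code, ja_eq_code]
    have hs' := hs
    rcases hs with ⟨rfl, h1⟩ | ⟨rfl, -, h1⟩ | ⟨rfl, h1⟩
    · exact h1
    · rwa [code_eq_prevCode (P + 1) σ hP, code_eq_prevCode (Q + 1) σ hQ]
    · have key : ∀ x y, CodesSplit 2 x y → x ∈ [0, 5, 2, 3] ∧ y ∈ [0, 5, 2, 3] ∧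
          (x == 3 || x == 5) ≠ (y == 3 || y == 5) := by decide
      obtain ⟨h2, h3, h4⟩ := key _ _ hs'
      have hirr : ∀ x, ¬CodesSplit 2 x x := by decide
      rw [Nat.sub_self, add_zero, add_zero, (hloc P σ hP).resolve_left (hirr _) h2,
        (hloc Q σ hQ).resolve_left (hirr _) h3]
      exact h4
  · by_cases h0 : e = 0
    · exact Or.inr h0
    · exact Or.inl (hs.code_eq h0).symm

/-! ### Occurrences that realise all the left special words. -/

theorem fixWord_eq_of_getElem? (m : ℕ) {p : ℕ} {x : Fin 6}
    (h : (substIter m [0])[p]? = some x) : fixWord p = x := by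
  obtain ⟨hp, -⟩ := List.getElem?_eq_some_iff.1 h
  rw [substIter_zero_getElem? m p hp] at h
  exact Option.some.inj h

/-- Every letter occurs in front of arbitrarily long prefixes of the fixed point. -/
theorem exists_letter_before_prefix (x : Fin 6) (σ : Bool) (n : ℕ) :
    ∃ P, fixWord (P + 2) = x ∧ Agree σ (P + 3) 0 n := by
  obtain ⟨p, h1, h2, h3⟩ : ∃ p, 2 ≤ p ∧ fixWord p = x ∧ fixWord (p + 1) = sgn σ := by
    have key : ∀ x σ, ∃ p < 80, 2 ≤ p ∧ (substIter 11 [0])[p]? = some x ∧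
        (substIter 11 [0])[p + 1]? = some (sgn σ) := by decide +kernel
    obtain ⟨p, -, h1, h2, h3⟩ := key x σ
    exact ⟨p, h1, fixWord_eq_of_getElem? _ h2, fixWord_eq_of_getElem? _ h3⟩
  -- A multiple of six iterations returns the last letter x to itself, while the `sgn σ` after it
  -- grows into a prefix of length N_{6n}.
  have h4 := (shiftIter_strictMono (6 * n)).id_le (p + 1)
  have h5 := fixWord_shiftIter_succ_sub_one (6 * n) p
  have h6 := Agree.shiftIter_one (j := 0) (τ := σ) h3 (by rw [h3, fixWord_zero, zero_add]) (6 * n)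
  obtain ⟨P, hP⟩ := Nat.exists_eq_add_of_le' (show 3 ≤ shiftIter (6 * n) (p + 1) by
    simp only [id] at h4; omega)
  have h7 : residue (6 * n) = 0 := Fin.ext (Nat.mul_mod_right 6 n)
  rw [hP, show P + 3 - 1 = P + 2 from rfl, h7, add_zero, h2] at h5
  rw [hP, shiftIter_zero_right] at h6
  refine ⟨P, h5, h6.mono ?_⟩
  have h8 := narayana_strictMono.id_le (6 * n)
  simp only [id] at h8
  omega

theorem leftWord_mem_leftSpecial (e : ℕ) (he : e ≤ 2) (b σ : Bool) (n : ℕ) :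
    (fun t : Fin n => leftWord e b σ ja t) ∈ leftSpecial ja n := by
  obtain ⟨x, y, hs, hx⟩ : ∃ x y, CodesSplit e x y ∧ (code x = b ∨ e = 0) := by
    have key : ∀ e ≤ 2, ∀ b, ∃ x y, CodesSplit e x y ∧ (code x = b ∨ e = 0) := by decide
    exact key e he b
  obtain ⟨P, hP, hPA⟩ := exists_letter_before_prefix x σ (n + 1)
  obtain ⟨Q, hQ, hQA⟩ := exists_letter_before_prefix y σ (n + 1)
  have hPQ : Agree false (P + 3) (Q + 3) (n + 1) := fun t ht => by
    rw [hPA t ht, hQA t ht]; simp [sgn]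
  have hP3 : fixWord (P + 3) = sgn σ := by simpa [fixWord_zero] using hPA 0 (by omega)
  have h := mem_leftSpecial_ja (n := n) (by rwa [hP, hQ]) hPA hPQ (by omega) hP3 (by omega)
  simp only [zero_add, ← ja_eq_code, hP] at h
  rcases hx with rfl | rfl
  · exact h
  · simpa [leftWord] using h

/-- The words 0010 and 503 occur at positions 22 and 11, and their complements 3343 and 230 at 3 and
52. -/
theorem exists_isBasePair_extra (σ : Bool) : ∃ p q, 2 ≤ p ∧ 2 ≤ q ∧ IsBasePair σ p q ∧
    fixWord p = sgn σ ∧ fixWord (q + 2) = 3 + sgn σ ∧ fixWord (p + 3) = sgn σ := by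
  have key : ∀ σ, ∃ p ∈ [3, 22], ∃ q ∈ [11, 52], (substIter 11 [0])[p]? = some (sgn σ) ∧
      (substIter 11 [0])[p + 1]? = some (sgn σ) ∧ (substIter 11 [0])[p + 2]? = some (1 + sgn σ) ∧
      (substIter 11 [0])[p + 3]? = some (sgn σ) ∧
      (substIter 11 [0])[q]? = some (5 + sgn σ) ∧ (substIter 11 [0])[q + 1]? = some (sgn σ) ∧
      (substIter 11 [0])[q + 2]? = some (3 + sgn σ) := by decide +kernel
  obtain ⟨p, hp, q, hq, h1, h2, h3, h4, h5, h6, h7⟩ := key σ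
  have f := @fixWord_eq_of_getElem? 11
  refine ⟨p, q, ?_, ?_, ⟨?_, f h2, f h3, f h5, f h6, Or.inr (f h7)⟩, f h1, f h7, f h4⟩
  · simp at hp; omega
  · simp at hq; omega
  · rw [f h1]; clear * -; revert σ; decide

theorem extraWord_mem_leftSpecial (m : ℕ) (σ : Bool) {n : ℕ}
    (hn : n ≤ narayana (m + 5) + m % 3 + narayana m) :
    (fun t : Fin n => extraWord m σ t) ∈ leftSpecial ja n := by
  obtain ⟨p, q, h2p, h2q, hb, hp, hq, hp'⟩ := exists_isBasePair_extra σ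
  have h1 := (hb.agree_long hq hp' m).1
  have h2 := hb.agree_twelve hq m
  have hp1 := fixWord_shiftIter_succ_sub_one (m + 4) p
  have hq1 := fixWord_shiftIter_succ_sub_one (m + 4) q
  have h3 := (shiftIter_strictMono (m + 4)).id_le (p + 1)
  have h4 := (shiftIter_strictMono (m + 4)).id_le (q + 1)
  have h5 : fixWord (shiftIter (m + 4) (p + 1)) = sgn σ := by
    rw [fixWord_shiftIter, hb.fst, substHead_iterate_sgn]
  simp only [id] at h3 h4
  obtain ⟨P, hP⟩ := Nat.exists_eq_add_of_le' (show 3 ≤ shiftIter (m + 4) (p + 1) by omega)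
  obtain ⟨Q, hQ⟩ := Nat.exists_eq_add_of_le' (show 3 ≤ shiftIter (m + 4) (q + 1) by omega)
  rw [hP, show P + 3 - 1 = P + 2 from rfl, hp] at hp1
  rw [hQ, show Q + 3 - 1 = Q + 2 from rfl, hb.left] at hq1
  rw [hP, hQ] at h1
  rw [hQ] at h2
  rw [hP] at h5
  have hpos : m + 5 ≤ narayana (m + 5) := narayana_strictMono.id_le _
  have := mem_leftSpecial_ja (n := n) (by rw [hp1, hq1]; exact codesSplit_sgn_add_residue σ m)
    (h1.trans_false h2) h1 (by omega) h5 (by omega)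
  rwa [hp1] at this

/-! ### The number of left special factors -/

/-- The parameters of the words `leftWord e b σ ja`, without repetition. -/
def leftWordIndex : Finset (Fin 3 × Bool × Bool) :=
  Finset.univ.filter fun x => x.1 = 0 → x.2.1 = false

/-- Two signs for e = 0, where b plays no role, and four choices of (b, σ) for each of e = 1 and e =
2. -/
theorem card_leftWordIndex : leftWordIndex.card = 10 := by decide

theorem exists_leftWordIndex (e : ℕ) (he : e ≤ 2) (b σ : Bool) :
    ∃ x ∈ leftWordIndex, leftWord e b σ ja = leftWord x.1 x.2.1 x.2.2 ja := by
  rcases Nat.eq_zero_or_pos e with rfl | h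
  · exact ⟨(0, false, σ), by simp [leftWordIndex], by funext t; simp [leftWord]⟩
  · refine ⟨(⟨e, by omega⟩, b, σ), Finset.mem_filter.2 ⟨Finset.mem_univ _, fun h0 => ?_⟩, rfl⟩
    exact absurd (congrArg Fin.val h0) h.ne'

theorem leftWord_injOn : ∀ x ∈ leftWordIndex, ∀ y ∈ leftWordIndex,
    (∀ t < 5, leftWord x.1 x.2.1 x.2.2 ja t = leftWord y.1 y.2.1 y.2.2 ja t) → x = y := by
  decide +kernel

/-- Images of 03 and 01 share N_{m+5} letters, and images of 01 start with a prefix of that length.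
Next comes the first letter of an iterated image of 4, of code 0, against that of φ^{m+5}(1) in
`ja`, of code 1. -/
theorem code_fixWord_shiftIter_twelve (m : ℕ) :
    (∀ t < narayana (m + 5), code (fixWord (shiftIter (m + 4) 12 + t)) = ja t) ∧
      code (fixWord (shiftIter (m + 4) 12 + narayana (m + 5))) ≠ ja (narayana (m + 5)) := by
  obtain ⟨p, q, -, -, hb, -, hq, -⟩ := exists_isBasePair_extra false
  have h1 := hb.agree_twelve hq m
  have h2 := hb.agree_zero (m + 4)
  obtain ⟨h3, -, h4⟩ := hb.agree_narayana_succ hq (m + 2)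
  have hpos : 0 < narayana m := by
    have : narayana 0 = 1 := rfl
    have := narayana_strictMono.monotone (Nat.zero_le m)
    omega
  constructor
  · intro t ht
    have h5 := h1 t (by omega)
    have h6 := h2 t ht
    have h7 := h3 t ht
    simp only [sgn, Bool.false_eq_true, if_false, add_zero, zero_add] at h5 h6 h7
    rw [ja_eq_code, ← h6, ← h5]
    exact congrArg code h7.symm
  · have h5 := h1 (narayana (m + 5)) (by omega)
    simp only [sgn, Bool.false_eq_true, if_false, add_zero] at h5
    have h6 : fixWord (shiftIter (m + 4) (q + 1) + narayana (m + 5)) =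
        substHead^[m + 2] (4 + sgn false) := by
      have h7 := congrArg fixWord h4
      rw [fixWord_shiftIter, (IsBasePair.snd_window hq).2.1] at h7
      exact h7
    have h7 : narayana (m + 5) = shiftIter (m + 5) 1 := by
      have := shiftIter_succ_of_sgn (σ := false) (i := 0) rfl (m + 5)
      rw [shiftIter_zero_right, zero_add, zero_add] at this
      exact this.symm
    have h8 : ja (narayana (m + 5)) = true := by
      rw [ja_eq_code, h7, fixWord_shiftIter]
      exact code_substHead_iterate_one (m + 5) false
    rw [← h5, h6, h8, code_substHead_iterate_four]
    simp

theorem extraWord_eq_leftWord (m : ℕ) (σ : Bool) (t : ℕ) (ht : t < narayana (m + 5) + m % 3) :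
    extraWord m σ t = leftWord (m % 3) (code (sgn σ + residue (m + 4))) σ ja t := by
  unfold extraWord leftWord
  split_ifs with h
  · rfl
  · exact congrArg (· ^^ σ) ((code_fixWord_shiftIter_twelve m).1 _ (by omega))

theorem extraWord_ne (m : ℕ) (σ : Bool) :
    extraWord m σ (narayana (m + 5) + m % 3) ≠
      leftWord (m % 3) (code (sgn σ + residue (m + 4))) σ ja (narayana (m + 5) + m % 3) := by
  have := (code_fixWord_shiftIter_twelve m).2
  simpa [extraWord, leftWord] using this

theorem narayana_five_le (m : ℕ) : 9 ≤ narayana (m + 5) :=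
  narayana_strictMono.monotone (show 5 ≤ m + 5 by omega)

/-- The intervals are disjoint: N_{a+6} = N_{a+5} + N_{a+2} + N_a, and N_{a+2} ≥ 3 exceeds a mod 3.
-/
theorem extraWord_unique {m m' n : ℕ} (h : narayana (m + 5) + m % 3 < n)
    (h' : n ≤ narayana (m + 5) + m % 3 + narayana m) (k : narayana (m' + 5) + m' % 3 < n)
    (k' : n ≤ narayana (m' + 5) + m' % 3 + narayana m') : m = m' := by
  have key : ∀ a b, a < b → narayana (a + 5) + a % 3 + narayana a ≤ narayana (b + 5) := by
    intro a b hab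
    have h1 := narayana_strictMono.monotone (show a + 6 ≤ b + 5 by omega)
    have h2 : narayana (a + 6) = narayana (a + 5) + narayana (a + 3) := rfl
    have h3 : narayana (a + 3) = narayana (a + 2) + narayana a := rfl
    have h4 := narayana_strictMono.monotone (show 2 ≤ a + 2 by omega)
    have h5 : narayana 2 = 3 := rfl
    omega
  rcases lt_trichotomy m m' with hlt | rfl | hlt
  · have := key _ _ hlt; omega
  · rfl
  · have := key _ _ hlt; omega

/-- The lengths for which there are exceptional left special factors. -/
def IsExtraLength (n : ℕ) : Prop :=
  ∃ m, narayana (m + 5) + m % 3 < n ∧ n ≤ narayana (m + 5) + m % 3 + narayana m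

theorem ncard_image_leftWord {n : ℕ} (hn : 5 ≤ n) :
    Set.ncard ((fun (x : Fin 3 × Bool × Bool) (t : Fin n) => leftWord x.1 x.2.1 x.2.2 ja t) ''
      leftWordIndex) = 10 := by
  rw [Set.InjOn.ncard_image, Set.ncard_coe_finset, card_leftWordIndex]
  intro x hx y hy hxy
  exact leftWord_injOn x hx y hy fun t ht => congrFun hxy ⟨t, by omega⟩

theorem ncard_leftSpecial_ja {n : ℕ} (hn : 11 ≤ n) :
    (IsExtraLength n → (leftSpecial ja n).ncard = 12) ∧
      (¬IsExtraLength n → (leftSpecial ja n).ncard = 10) := by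
  set A := (fun (x : Fin 3 × Bool × Bool) (t : Fin n) => leftWord x.1 x.2.1 x.2.2 ja t) ''
    leftWordIndex with hA
  have hA10 : A.ncard = 10 := ncard_image_leftWord (by omega)
  have hAsub : A ⊆ leftSpecial ja n := by
    rintro _ ⟨x, -, rfl⟩
    exact leftWord_mem_leftSpecial x.1 (by omega) _ _ n
  have hmem : ∀ e ≤ 2, ∀ b σ, (fun t : Fin n => leftWord e b σ ja t) ∈ A := by
    intro e he b σ
    obtain ⟨x, hx, h⟩ := exists_leftWordIndex e he b σ
    exact ⟨x, hx, by rw [h]⟩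
  constructor
  · rintro ⟨m, h1, h2⟩
    have h9 := narayana_five_le m
    have hset : leftSpecial ja n =
        A ∪ (fun (σ : Bool) (t : Fin n) => extraWord m σ t) '' Set.univ := by
      ext u
      constructor
      · intro hu
        obtain ⟨σ, ⟨e, he, b, rfl⟩ | ⟨m', h3, h4, rfl⟩⟩ := leftSpecial_ja_subset hn hu
        · exact Or.inl (hmem e he b σ)
        · obtain rfl := extraWord_unique h1 h2 h3 h4
          exact Or.inr ⟨σ, trivial, rfl⟩
      · rintro (hu | ⟨σ, -, rfl⟩)
        · exact hAsub hu
        · exact extraWord_mem_leftSpecial m σ h2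
    -- The first five letters already determine which of the ten words it would have to be, and from
    -- that one it differs at position N_{m+5} + m mod 3 < n.
    have hnot : ∀ σ, (fun t : Fin n => extraWord m σ t) ∉ A := by
      rintro σ ⟨x, hx, hxe⟩
      obtain ⟨y, hy, hye⟩ := exists_leftWordIndex (m % 3) (by omega)
        (code (sgn σ + residue (m + 4))) σ
      have hxy : x = y := by
        refine leftWord_injOn x hx y hy fun t ht => ?_
        rw [← hye, ← extraWord_eq_leftWord m σ t (by omega)]
        exact congrFun hxe ⟨t, by omega⟩
      refine extraWord_ne m σ ?_
      rw [hye, ← hxy]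
      exact (congrFun hxe ⟨_, h1⟩).symm
    have hinj : Function.Injective fun (σ : Bool) (t : Fin n) => extraWord m σ t := by
      have hne : (fun t : Fin n => extraWord m false t) ≠ fun t : Fin n => extraWord m true t := by
        intro h
        -- The first letter after b^e is the first letter of `ja` with the sign added, so it reveals
        -- σ.
        have h3 := congrFun h ⟨m % 3, by omega⟩
        simp only at h3
        rw [extraWord_eq_leftWord m false _ (by omega), extraWord_eq_leftWord m true _ (by omega)]
          at h3
        simp [leftWord] at h3
      intro σ τ h
      cases σ <;> cases τ
      · rfl
      · exact absurd h hne
      · exact absurd h.symm hne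
      · rfl
    have hdisj : Disjoint A ((fun (σ : Bool) (t : Fin n) => extraWord m σ t) '' Set.univ) := by
      rw [Set.disjoint_left]
      rintro _ hu ⟨σ, -, rfl⟩
      exact hnot σ hu
    rw [hset, Set.ncard_union_eq hdisj, Set.ncard_image_of_injective _ hinj, hA10]
    simp
  · intro hne
    rw [← hA10]
    congr 1
    refine Set.Subset.antisymm (fun u hu => ?_) hAsub
    obtain ⟨σ, ⟨e, he, b, rfl⟩ | ⟨m', h3, h4, rfl⟩⟩ := leftSpecial_ja_subset hn hu
    · exact hmem e he b σ
    · exact absurd ⟨m', h3, h4⟩ hne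

theorem jaDiff_eq_ncard (n : ℕ) : jaDiff n = (leftSpecial ja n).ncard := by
  rw [jaDiff, subwordComplexity_succ]
  · push_cast; ring
  · intro n
    obtain ⟨P, -, hP⟩ := exists_letter_before_prefix 0 false n
    refine ⟨P + 2, funext fun t => ?_⟩
    have := hP t t.2
    simp only [sgn, Bool.false_eq_true, if_false, add_zero] at this
    simp only [factorAt, ja_eq_code]
    exact congrArg code this

theorem jaDiff_eq_twelve {n : ℕ} (hn : 11 ≤ n) (h : IsExtraLength n) : jaDiff n = 12 := by
  rw [jaDiff_eq_ncard, (ncard_leftSpecial_ja hn).1 h]; rfl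

theorem jaDiff_eq_ten {n : ℕ} (hn : 11 ≤ n) (h : ¬IsExtraLength n) : jaDiff n = 10 := by
  rw [jaDiff_eq_ncard, (ncard_leftSpecial_ja hn).2 h]; rfl

/-! ### Short lengths -/

/-- The factors of length `11` of the fixed point. -/
def fixFactorsEleven : List (List (Fin 6)) :=
  listFactors 11 (substIter 16 [0])
    [0, 1, 2, 3, 4, 5, 6, 7, 8, 9, 10, 11, 12, 13, 14, 15, 16, 17, 18, 19, 20, 21, 22, 23, 24, 25,
      26, 27, 28, 29, 30, 31, 32, 33, 34, 35, 36, 37, 38, 39, 40, 44, 45, 46, 47, 48, 49, 50, 51,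
      52, 53, 54, 55, 56, 57, 58, 59, 69, 70, 71, 72, 73, 74, 75, 76, 77, 78, 82, 83, 84, 85, 86,
      87, 106, 107, 108, 109, 110, 111, 112, 113, 114, 115, 125, 126, 127, 128, 162, 163, 164, 165,
      166, 167, 168, 169, 188, 242, 243, 244, 245, 246, 247, 248, 361, 362, 363, 364, 534]

theorem fixWindow_eleven_mem (p : ℕ) : fixWindow p 11 ∈ fixFactorsEleven := by
  refine fixWindow_mem_of_closed 11 _ ?_ ?_ ?_ p <;> decide +kernel

theorem exists_fixWindow_of_mem_listFactors {L m : ℕ} {ps : List ℕ} {v : List (Fin 6)}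
    (hv : v ∈ listFactors L (substIter m [0]) ps) (hL : v.length = L) : ∃ p, v = fixWindow p L := by
  simp only [listFactors, List.mem_map] at hv
  obtain ⟨p, hp, rfl⟩ := hv
  refine ⟨p, List.ext_getElem (by simpa using hL) fun t h1 h2 => ?_⟩
  have h3 := substIter_zero_getElem? m (p + t) (by simp at h1; omega)
  rw [fixWindow_getElem, List.getElem_take, List.getElem_drop]
  rw [List.getElem?_eq_some_iff] at h3
  exact h3.choose_spec

/-- The code of a word, read as a binary number with the least significant digit first. -/
def binaryCode : List (Fin 6) → ℕ
  | [] => 0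
  | x :: l => 2 * binaryCode l + (code x).toNat

theorem ofBits_factorAt_ja (n p : ℕ) :
    Nat.ofBits (factorAt ja n p) = binaryCode (fixWindow p n) := by
  induction n generalizing p with
  | zero => rfl
  | succ n ih =>
    have h : fixWindow p (n + 1) = fixWord p :: fixWindow (p + 1) n := by
      rw [add_comm, fixWindow_append]; rfl
    rw [Nat.ofBits_succ, h, binaryCode, ← ih, factorAt_succ, Fin.cons_zero, ja_eq_code]
    rfl

/-- With the first letter as least significant digit, truncating a factor is reduction mod 2^n. One
list of factors of length 11 thus serves all shorter lengths. -/
theorem ofBits_factorAt_mod (n p : ℕ) (hn : n ≤ 11) :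
    Nat.ofBits (factorAt ja n p) = Nat.ofBits (factorAt ja 11 p) % 2 ^ n := by
  refine Nat.eq_of_testBit_eq fun i => ?_
  rw [Nat.testBit_mod_two_pow]
  by_cases h : i < n
  · rw [Nat.testBit_ofBits_lt _ _ h, Nat.testBit_ofBits_lt _ _ (h.trans_le hn)]
    simp [h, factorAt]
  · rw [Nat.testBit_ofBits_ge _ _ (not_lt.1 h)]
    simp [h]

/-- The binary numbers of the factors of length `11` of the Allouche–Johnson word. -/
def binaryFactorsEleven : List ℕ :=
  [606, 303, 151, 1099, 549, 274, 137, 68, 1058, 1553, 776, 388, 194, 97, 1072, 536, 1292, 1670,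
    1859, 929, 464, 232, 116, 1082, 541, 1294, 1671, 835, 1441, 1744, 1896, 1972, 986, 493, 246,
    123, 1085, 542, 1295, 948, 1498, 1773, 1910, 1979, 989, 1518, 759, 379, 189, 94, 1071, 535,
    1291, 1669, 834, 494, 1271, 1659, 1853, 1950, 975, 1511, 755, 377, 1212, 75, 1061, 530, 1289,
    1668, 188, 1118, 1583, 1815, 1931, 965, 1506, 753, 376, 529, 1288, 1554, 1801, 1924, 962,
    1505, 752, 1858, 1953, 976, 1512, 756, 378, 1213, 1517, 758]

theorem mem_binaryFactorsEleven (k : ℕ) :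
    k ∈ binaryFactorsEleven ↔ ∃ p, Nat.ofBits (factorAt ja 11 p) = k := by
  constructor
  · have key : ∀ k ∈ binaryFactorsEleven,
        ∃ v ∈ fixFactorsEleven, v.length = 11 ∧ binaryCode v = k := by decide +kernel
    intro hk
    obtain ⟨v, hv, hl, rfl⟩ := key k hk
    obtain ⟨p, rfl⟩ := exists_fixWindow_of_mem_listFactors hv hl
    exact ⟨p, ofBits_factorAt_ja 11 p⟩
  · have key : ∀ v ∈ fixFactorsEleven, binaryCode v ∈ binaryFactorsEleven := by decide +kernel
    rintro ⟨p, rfl⟩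
    rw [ofBits_factorAt_ja]
    exact key _ (fixWindow_eleven_mem p)

theorem ofBits_injective (n : ℕ) : Function.Injective (Nat.ofBits : (Fin n → Bool) → ℕ) := by
  intro f g h
  funext t
  rw [← Nat.testBit_ofBits_lt f t t.2, h, Nat.testBit_ofBits_lt g t t.2]

theorem subwordComplexity_ja_eq_length {n : ℕ} (hn : n ≤ 11) :
    subwordComplexity ja n = (binaryFactorsEleven.map (· % 2 ^ n)).dedup.length := by
  rw [subwordComplexity, ← Set.ncard_image_of_injective _ (ofBits_injective n),
    ← List.card_toFinset, ← Set.ncard_coe_finset]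
  congr 1
  ext k
  simp only [Set.mem_image, Set.mem_range, exists_exists_eq_and, List.coe_toFinset, List.mem_map,
    Set.mem_ofPred_eq, mem_binaryFactorsEleven, ofBits_factorAt_mod n _ hn]

theorem subwordComplexity_ja_of_le_eleven {n : ℕ} (hn : n ≤ 11) :
    subwordComplexity ja n = [1, 2, 4, 8, 16, 28, 40, 52, 62, 72, 84, 96].getD n 0 := by
  have key : ∀ n ≤ 11, (binaryFactorsEleven.map (· % 2 ^ n)).dedup.length =
      [1, 2, 4, 8, 16, 28, 40, 52, 62, 72, 84, 96].getD n 0 := by decide +kernel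
  rw [subwordComplexity_ja_eq_length hn, key n hn]

theorem jaDiff_of_le_ten {n : ℕ} (hn : n ≤ 10) :
    jaDiff n = [1, 2, 4, 8, 12, 12, 12, 10, 10, 12, 12].getD n 0 := by
  rw [jaDiff, subwordComplexity_ja_of_le_eleven (by omega),
    subwordComplexity_ja_of_le_eleven (by omega)]
  interval_cases n <;> rfl

/-- The interval for m = 0 is {10}, that for m = 1 is {15, 16}, and all others lie above N_7 = 19.
-/
theorem isExtraLength_iff_of_lt {n : ℕ} (h : 11 ≤ n) (h' : n < 19) :
    IsExtraLength n ↔ n = 15 ∨ n = 16 := by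
  constructor
  · rintro ⟨m, h1, h2⟩
    have hm : m < 2 := by
      by_contra hm
      have : narayana 7 ≤ narayana (m + 5) := narayana_strictMono.monotone (by omega)
      have h7 : narayana 7 = 19 := rfl
      omega
    interval_cases m <;> simp [narayana] at h1 h2 <;> omega
  · intro h
    exact ⟨1, by simp [narayana]; omega, by simp [narayana]; omega⟩

/-- The first values of `jaDiff`. -/
def shortJaDiff (n : ℕ) : ℤ :=
  [1, 2, 4, 8, 12, 12, 12, 10, 10, 12, 12, 10, 10, 10, 10, 12, 12, 10, 10].getD n 0

theorem jaDiff_of_lt_nineteen {n : ℕ} (hn : n < 19) : jaDiff n = shortJaDiff n := by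
  rcases Nat.lt_or_ge n 11 with h | h
  · rw [jaDiff_of_le_ten (by omega)]
    interval_cases n <;> rfl
  · by_cases he : n = 15 ∨ n = 16
    · rw [jaDiff_eq_twelve h ((isExtraLength_iff_of_lt h hn).2 he)]
      rcases he with rfl | rfl <;> rfl
    · rw [jaDiff_eq_ten h fun h1 => he ((isExtraLength_iff_of_lt h hn).1 h1)]
      interval_cases n <;> first | rfl | omega

/-! ### The runs of the automata -/

/-- The run of the automata from a state. -/
def fdiffRun (q : Fin 31) (w : List Bool) : Option (Fin 31) := w.foldlM fdiffStep q

theorem fdiffRun_cons (q : Fin 31) (e : Bool) (w : List Bool) :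
    fdiffRun q (e :: w) = (fdiffStep q e).bind fun q' => fdiffRun q' w := by
  simp [fdiffRun, List.foldlM_cons, Option.bind_eq_bind]

/-- The digits at the end of an input that leads to a state, as far as they constrain the
continuation. -/
def stateContext (q : Fin 31) : List Bool :=
  if q ∈ ([1, 5, 7, 10, 14, 17, 19, 24, 29] : List (Fin 31)) then [true]
  else if q ∈ ([2, 8, 11, 15, 20, 25, 30] : List (Fin 31)) then [true, false]
  else []

/-- A 1 is forbidden exactly after 1 or 10, and every state knows whether the input ended so. -/
theorem isSome_fdiffRun (q : Fin 31) (w : List Bool) :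
    (fdiffRun q w).isSome ↔ NarayanaAdmissible (stateContext q ++ w) := by
  induction w generalizing q with
  | nil =>
    have : ∀ q, stateContext q = [] ∨ stateContext q = [true] ∨ stateContext q = [true, false] := by
      decide
    have h : NarayanaAdmissible (stateContext q) := by
      rcases this q with h | h | h <;> rw [h]
      · exact narayanaAdmissible_nil
      · exact (narayanaAdmissible_true _).2 (Or.inl rfl)
      · exact (narayanaAdmissible_true _).2 (Or.inr (Or.inl rfl))
    simpa [fdiffRun] using h
  | cons e w ih =>
    have key : ∀ q, (∃ q', fdiffStep q false = some q' ∧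
        (stateContext q = [] ∧ stateContext q' = [] ∨
          stateContext q = [true] ∧ stateContext q' = [true, false] ∨
          stateContext q = [true, false] ∧ stateContext q' = [])) ∧
        ((∃ q', fdiffStep q true = some q' ∧ stateContext q = [] ∧ stateContext q' = [true]) ∨
          fdiffStep q true = none ∧
            (stateContext q = [true] ∨ stateContext q = [true, false])) := by decide
    obtain ⟨⟨q', h1, h2⟩, h3⟩ := key q
    rw [fdiffRun_cons]
    cases e
    · rw [h1, Option.bind_some, ih]
      rcases h2 with ⟨h4, h5⟩ | ⟨h4, h5⟩ | ⟨h4, h5⟩ <;> rw [h4, h5]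
      · exact (narayanaAdmissible_false w).symm
      · rfl
      · simp [narayanaAdmissible_true]
    · rcases h3 with ⟨q', h4, h5, h6⟩ | ⟨h4, h5⟩
      · rw [h4, Option.bind_some, ih, h5, h6]; rfl
      · rw [h4]
        rcases h5 with h5 | h5 <;> rw [h5] <;> simp [narayanaAdmissible_true]

theorem narayanaValue_lt_of_fdiffRun {q r : Fin 31} {w : List Bool} (h : fdiffRun q w = some r) :
    narayanaValue w < narayana w.length := by
  have h1 := (isSome_fdiffRun q w).1 (by rw [h]; rfl)
  refine narayanaValue_lt w ?_
  generalize stateContext q = l at h1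
  induction l with
  | nil => exact h1
  | cons a l ih => exact ih h1.tail

/-- The condition for `fdiff12` to accept, from the state `q`, a word of length `l` and value
`v`. -/
def acceptCondition (q : Fin 31) (l v : ℕ) : Prop :=
  -- The first states have both bounds decided and satisfied. Then come states where only the lower
  -- bound is open, those where only the upper bound is, and 6, 4, 3, where both are.
  if q ∈ ([14, 19, 20, 24, 25, 26] : List (Fin 31)) then True
  else if q ∈ ([9, 23] : List (Fin 31)) then l % 3 + 1 ≤ v
  else if q = 13 then (l + 1) % 3 + 1 ≤ v
  else if q = 18 then (l + 2) % 3 + 1 ≤ v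
  else if q ∈ ([10, 27] : List (Fin 31)) then v ≤ l % 3
  else if q ∈ ([15, 28] : List (Fin 31)) then v ≤ (l + 1) % 3
  else if q = 21 then v ≤ (l + 2) % 3
  else if q = 6 then (l + 2) % 3 + 1 ≤ v ∧ v ≤ (l + 2) % 3 + narayana (l - 1)
  else if q = 4 then (l + 1) % 3 + 1 ≤ v ∧ v ≤ (l + 1) % 3 + narayana (l - 2)
  else if q = 3 then l % 3 + 1 ≤ v ∧ v ≤ l % 3 + narayana (l - 3)
  else False

instance (q : Fin 31) (l v : ℕ) : Decidable (acceptCondition q l v) := by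
  unfold acceptCondition; infer_instance

/-- One step of the automata from a state `q ≥ 3`, in terms of `acceptCondition`. -/
theorem acceptCondition_step {l v : ℕ} (hl : 4 ≤ l) (hv : v < narayana l) (q q' : Fin 31)
    (e : Bool) (hq : 3 ≤ q) (h : fdiffStep q e = some q') :
    3 ≤ q' ∧ (acceptCondition q' l v ↔
      acceptCondition q (l + 1) ((if e then narayana l else 0) + v)) := by
  obtain ⟨d, rfl⟩ := Nat.exists_eq_add_of_le' hl
  have h4 : 4 + 2 ≤ narayana (d + 4) := narayana_strictMono.monotone (show 4 ≤ d + 4 by omega)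
  have n4 : narayana (d + 4) = narayana (d + 3) + narayana (d + 1) := rfl
  have n3 : narayana (d + 3) = narayana (d + 2) + narayana d := rfl
  have m1 : 2 ≤ narayana (d + 1) := narayana_strictMono.monotone (show 1 ≤ d + 1 by omega)
  have m0 : 1 ≤ narayana d := narayana_strictMono.monotone (show 0 ≤ d by omega)
  -- N_{d+1} has to exceed remainders mod 3. Only N_1 = 2 is too small in general, and for d = 0 the
  -- remainders are explicit.
  have m2 : d = 0 ∨ 3 ≤ narayana (d + 1) := by
    rcases Nat.eq_zero_or_pos d with h | h
    · exact Or.inl h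
    · exact Or.inr (narayana_strictMono.monotone (show 2 ≤ d + 1 by omega))
  have s1 : d + 4 + 1 - 1 = d + 4 := by omega
  have s2 : d + 4 + 1 - 2 = d + 3 := by omega
  have s3 : d + 4 + 1 - 3 = d + 2 := by omega
  have s4 : d + 4 - 1 = d + 3 := by omega
  have s5 : d + 4 - 2 = d + 2 := by omega
  fin_cases q <;> cases e <;> simp [fdiffStep] at hq h
  all_goals
    subst h
    refine ⟨by decide, ?_⟩
    simp [acceptCondition, s1, s2, s3, s4, s5]
    try omega

/-- Digits are read off by `acceptCondition_step` until four remain, and those words are checked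
exhaustively. Shorter words can violate the equivalence: state 5 accepts the empty word for
`fdiff12`, though its condition is `False`. -/
theorem mem_accept_iff (v : List Bool) (hv : 4 ≤ v.length) (q r : Fin 31) (hq : 3 ≤ q)
    (h : fdiffRun q v = some r) :
    (r ∈ fdiff12.accept ↔ acceptCondition q v.length (narayanaValue v)) ∧
      (r ∈ fdiff10.accept ↔ ¬acceptCondition q v.length (narayanaValue v)) := by
  induction v generalizing q with
  | nil => simp at hv
  | cons e v ih =>
    rcases Nat.lt_or_ge v.length 4 with h3 | h3
    · simp only [List.length_cons] at hv
      have key : ∀ a b c d : Bool, ∀ q r : Fin 31, 3 ≤ q → fdiffRun q [a, b, c, d] = some r →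
          (r ∈ fdiff12.accept ↔ acceptCondition q 4 (narayanaValue [a, b, c, d])) ∧
            (r ∈ fdiff10.accept ↔ ¬acceptCondition q 4 (narayanaValue [a, b, c, d])) := by
        decide +kernel
      match v, h3, hv with
      | [a, b, c], _, _ => exact key e a b c q r hq h
    · rw [fdiffRun_cons] at h
      obtain ⟨q', h1, h2⟩ := Option.bind_eq_some_iff.1 h
      obtain ⟨h4, h5⟩ := acceptCondition_step h3 (narayanaValue_lt_of_fdiffRun h2) q q' e hq h1
      rw [List.length_cons, narayanaValue, ← h5]
      exact ih h3 q' h4 h2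

/-! ### The main theorem -/

theorem narayanaRep_eq {w : List Bool} {n : ℕ} (h : IsNarayanaRep w n) : narayanaRep n = w :=
  (existsUnique_isNarayanaRep n).unique (narayanaRep_spec n) h

/-- The interval with index m lies strictly between N_{m+5} and N_{m+6}, and n = N_{l+2} + v lies in
[N_{l+2}, N_{l+3}). This forces m = l - 3, which is congruent to l mod 3. -/
theorem isExtraLength_iff_acceptCondition {l v : ℕ} (hl : 4 ≤ l) (hv : v < narayana l) :
    IsExtraLength (narayana (l + 2) + v) ↔ acceptCondition 3 l v := by
  obtain ⟨d, rfl⟩ := Nat.exists_eq_add_of_le' (show 3 ≤ l by omega)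
  have hc : acceptCondition 3 (d + 3) v ↔ d % 3 + 1 ≤ v ∧ v ≤ d % 3 + narayana d := by
    simp [acceptCondition]
  rw [hc, show narayana (d + 3 + 2) = narayana (d + 5) from rfl]
  have n1 : narayana (d + 6) = narayana (d + 5) + narayana (d + 3) := rfl
  have n4 : narayana (d + 3) = narayana (d + 2) + narayana d := rfl
  constructor
  · rintro ⟨m, h1, h2⟩
    have hmd : m = d := by
      have n2 : narayana (m + 6) = narayana (m + 5) + narayana (m + 3) := rfl
      have n3 : narayana (m + 3) = narayana (m + 2) + narayana m := rfl
      have n5 : 3 ≤ narayana (m + 2) := narayana_strictMono.monotone (show 2 ≤ m + 2 by omega)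
      rcases lt_trichotomy m d with hlt | rfl | hlt
      · have := narayana_strictMono.monotone (show m + 6 ≤ d + 5 by omega)
        omega
      · rfl
      · have := narayana_strictMono.monotone (show d + 6 ≤ m + 5 by omega)
        omega
    subst hmd
    omega
  · rintro ⟨h1, h2⟩
    exact ⟨d, by omega, by omega⟩

/-- The canonical representations of the numbers below `19`. -/
def shortNarayanaRep (n : ℕ) : List Bool :=
  [[], [true], [true, false], [true, false, false],
    [true, false, false, false], [true, false, false, true],
    [true, false, false, false, false], [true, false, false, false, true],
    [true, false, false, true, false],
    [true, false, false, false, false, false], [true, false, false, false, false, true],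
    [true, false, false, false, true, false], [true, false, false, true, false, false],
    [true, false, false, false, false, false, false],
    [true, false, false, false, false, false, true],
    [true, false, false, false, false, true, false],
    [true, false, false, false, true, false, false],
    [true, false, false, true, false, false, false],
    [true, false, false, true, false, false, true]].getD n []

theorem fdiffRun_narayanaRep (n : ℕ) :
    ∃ r, fdiffRun 0 (narayanaRep n) = some r ∧ (r ∈ fdiff12.accept ↔ jaDiff n = 12) ∧
      (r ∈ fdiff10.accept ↔ jaDiff n = 10) ∧ (4 ≤ n → jaDiff n = 10 ∨ jaDiff n = 12) := by
  -- From 19 = N_7 on, the representation has at least eight digits, so at least four follow the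
  -- leading 100.
  rcases Nat.lt_or_ge n 19 with hn | hn
  · rw [jaDiff_of_lt_nineteen hn]
    have key : ∀ w : List Bool, IsNarayanaRep w n → ∀ x : ℤ,
        (∃ r, fdiffRun 0 w = some r ∧ (r ∈ fdiff12.accept ↔ x = 12) ∧
          (r ∈ fdiff10.accept ↔ x = 10) ∧ (4 ≤ n → x = 10 ∨ x = 12)) →
        ∃ r, fdiffRun 0 (narayanaRep n) = some r ∧ (r ∈ fdiff12.accept ↔ x = 12) ∧
          (r ∈ fdiff10.accept ↔ x = 10) ∧ (4 ≤ n → x = 10 ∨ x = 12) := by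
      intro w hw x h
      rwa [narayanaRep_eq hw]
    have table : ∀ n < 19, narayanaValue (shortNarayanaRep n) = n ∧
        (shortNarayanaRep n).head? ≠ some false ∧
        ∃ r, fdiffRun 0 (shortNarayanaRep n) = some r ∧
          (r ∈ fdiff12.accept ↔ shortJaDiff n = 12) ∧ (r ∈ fdiff10.accept ↔ shortJaDiff n = 10) ∧
          (4 ≤ n → shortJaDiff n = 10 ∨ shortJaDiff n = 12) := by
      decide +kernel
    obtain ⟨hw, hw', r, hr, h⟩ := table n hn
    have hadm : NarayanaAdmissible (shortNarayanaRep n) :=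
      (isSome_fdiffRun 0 (shortNarayanaRep n)).1 (by rw [hr]; rfl)
    exact key _ ⟨hw', hadm, hw⟩ _ ⟨r, hr, h⟩
  · obtain ⟨h1, h2, h3⟩ := narayanaRep_spec n
    have h4 := narayanaValue_lt _ h2
    rw [h3] at h4
    have hlen : 7 < (narayanaRep n).length := by
      by_contra hlt
      have : narayana (narayanaRep n).length ≤ narayana 7 :=
        narayana_strictMono.monotone (by omega)
      have h7 : narayana 7 = 19 := rfl
      omega
    obtain ⟨v, hv⟩ : ∃ v, narayanaRep n = true :: false :: false :: v := by
      generalize narayanaRep n = w at h1 h2 hlen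
      match w with
      | [] => simp at hlen
      | false :: w => simp at h1
      | true :: w =>
        rcases (narayanaAdmissible_true w).1 h2 with rfl | rfl | ⟨v, rfl, -⟩
        · simp at hlen
        · simp at hlen
        · exact ⟨v, rfl⟩
    rw [hv] at h2 h3 hlen ⊢
    have hl : 4 ≤ v.length := by simp at hlen; omega
    have hn' : n = narayana (v.length + 2) + narayanaValue v := by
      simpa [narayanaValue] using h3.symm
    obtain ⟨r, hr⟩ := Option.isSome_iff_exists.1 ((isSome_fdiffRun 0 _).2 h2)
    -- The digits 100 lead from state 0 to state 3.
    have hr' : fdiffRun 3 v = some r := hr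
    obtain ⟨h5, h6⟩ := mem_accept_iff v hl 3 r le_rfl hr'
    rw [← isExtraLength_iff_acceptCondition hl (narayanaValue_lt_of_fdiffRun hr'), ← hn'] at h5 h6
    refine ⟨r, hr, ?_⟩
    rw [h5, h6]
    by_cases he : IsExtraLength n
    · simp [jaDiff_eq_twelve (by omega) he, he]
    · simp [jaDiff_eq_ten (by omega) he, he]

/-! ### Leading zeros and the recognised sets. -/

theorem fdiffRun_replicate (k : ℕ) (w : List Bool) :
    fdiffRun 0 (List.replicate k false ++ w) = fdiffRun 0 w := by
  induction k with
  | zero => rfl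
  | succ k ih => rw [List.replicate_succ, List.cons_append, fdiffRun_cons]; exact ih

theorem exists_replicate_append_narayanaRep (w : List Bool) (h : NarayanaAdmissible w) :
    ∃ k, w = List.replicate k false ++ narayanaRep (narayanaValue w) := by
  induction w with
  | nil => exact ⟨0, (narayanaRep_eq ⟨by simp, h, rfl⟩).symm⟩
  | cons a w ih =>
    cases a
    · obtain ⟨k, hk⟩ := ih h.tail
      refine ⟨k + 1, ?_⟩
      have : narayanaValue (false :: w) = narayanaValue w := by simp [narayanaValue]
      rw [this, List.replicate_succ, List.cons_append, ← hk]
    · exact ⟨0, (narayanaRep_eq ⟨by simp, h, rfl⟩).symm⟩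

/-- Runs survive exactly on admissible words, and these are the canonical representations padded
with zeros, on which state 0 loops. It therefore suffices to know the run on each `narayanaRep n`.
-/
theorem recognizes_of_accept {M : PartialAutomaton 31} (hstep : M.step = fdiffStep)
    (hstart : M.start = 0) {S : Set ℕ}
    (h : ∀ n, ∃ r, fdiffRun 0 (narayanaRep n) = some r ∧ (r ∈ M.accept ↔ n ∈ S)) :
    M.Recognizes S := by
  have hacc : ∀ w, M.Accepts w ↔ ∃ r, fdiffRun 0 w = some r ∧ r ∈ M.accept := by
    intro w
    rw [PartialAutomaton.Accepts, hstep, hstart]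
    rfl
  intro w
  rw [hacc]
  constructor
  · rintro ⟨r, hr, hrM⟩
    have hw : NarayanaAdmissible w := (isSome_fdiffRun 0 w).1 (by rw [hr]; rfl)
    obtain ⟨k, hk⟩ := exists_replicate_append_narayanaRep w hw
    obtain ⟨r', hr', hS⟩ := h (narayanaValue w)
    rw [hk, fdiffRun_replicate, hr'] at hr
    obtain rfl := Option.some.inj hr
    exact ⟨_, hS.1 hrM, k, hk⟩
  · rintro ⟨n, hn, k, rfl⟩
    obtain ⟨r, hr, hS⟩ := h n
    exact ⟨r, by rw [fdiffRun_replicate, hr], hS.2 hn⟩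

theorem theorem42 :
    fdiff10.Recognizes {n | jaDiff n = 10} ∧
    fdiff12.Recognizes {n | jaDiff n = 12} ∧
    ∀ n : ℕ, 4 ≤ n → jaDiff n = 10 ∨ jaDiff n = 12 := by
  refine ⟨recognizes_of_accept rfl rfl fun n => ?_, recognizes_of_accept rfl rfl fun n => ?_,
    fun n => ?_⟩
  · obtain ⟨r, h1, -, h3, -⟩ := fdiffRun_narayanaRep n
    exact ⟨r, h1, h3⟩
  · obtain ⟨r, h1, h2, -, -⟩ := fdiffRun_narayanaRep n
    exact ⟨r, h1, h2⟩
  · obtain ⟨r, -, -, -, h4⟩ := fdiffRun_narayanaRep n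
    exact h4
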